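/- Setting. Let $(X,Y)\sim P$, let $f$ be a model and $\ell$ a loss with $0\le \ell(f(x),y)\le 1$, and let $R=\mathbb E\,\ell(f(X),Y)$. For $K\ge 1$ the equally spaced partition consists of the cells $A_k=\{(x,y):\ell(f(x),y)\in[\frac{k-1}{K},\frac kK)\}$, $k=1,\dots,K$ (the last cell also contains loss value $1$); let $\mu_k=P(A_k)$ and $v_k=\mathrm{Var}(\ell(f(X),Y)\mid A_k)$. For shares $w_1,\dots,w_K$ call the partition benign if $w_k\ge \ln(K+1)\max\{v_k,\varepsilon^{2/3}\}$ for all $k$. Let $D_n$ be $n$ i.i.d. points from $P$, $N_k$ the number of them in $A_k$, and write $T(\varepsilon,\delta)=\varepsilon^{-2}\{\ln(1/\delta)+\ln\ln(1/\varepsilon)\}$. Algorithm (Cer-Eval with this partition, error level $\varepsilon$, failure probability $\delta$, warm start $m$). Evaluate the first $m$ points of $D_n$. In each round, for each cell with $n_k$ evaluated points, empirical mean $\hat R_k$ and empirical variance $\hat v_k$, put $\eta_k=\sqrt{\{2\ln(\log_2 n_k+1)+\ln(16K/\delta)\}/n_k}$ and $\varepsilon_k=\frac23\eta_k^2+2\sqrt{(\hat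 v_k+\eta_k+\eta_k^2)\eta_k^2}$ ($\varepsilon_k=\infty$ if $n_k=0$), and produce the confidence interval with centre $\hat R=\sum_k \frac{N_k}{n}\hat R_k$ and radius $\hat\varepsilon=\sum_k\frac{N_k}{n}\varepsilon_k$. Stop if $\hat\varepsilon\le\varepsilon$ or all points are evaluated; otherwise evaluate the next point of a cell that maximizes $\frac{N_k}{n}\left|\partial\varepsilon_k/\partial n_k\right|$ among the cells with unevaluated points (unevaluated cells have priority $\infty$; the order of the dataset is used). The algorithm is $(n',\varepsilon,\delta)$-certified if with probability at least $1-\delta$ it evaluates fewer than $n'$ points, attains radius at most $\varepsilon$, and all its confidence intervals contain $R$. The saving ratio is $\rho=n'/n$, where $n=\Theta(T(\varepsilon,\delta))$. Assume that the law of the loss has a Lebesgue density $h$ with $h(z)\ge A\exp(-z^2/\sigma^2)$ for $z\in[0,1]$, where $A,\sigma>0$. Claim. There is an absolute constant $c_0>0$ such that for every $c_1\ge c_0$ the following hold, where always $0<\delta<1$, $c_0T(\varepsilon,\delta)\le n\le c_1T(\varepsilon,\delta)$ and $m\le 1/\varepsilon$. (1) There are constants $C,\varepsilon_0>0$, depending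 only on $c_1$, such that for all $0<\varepsilon\le\varepsilon_0$ and all $K$ with $K/\ln(K+1)\ge e^{1/\sigma^2}/A$ and $K\le\varepsilon^{-1/3}$: the equally spaced partition is benign with $w_k=\mu_k$; it is benign with $w_k=2N_k/n$ with probability at least $1-\delta$; and the algorithm is $(n',\varepsilon,\delta)$-certified for some $n'$ with $\rho=n'/n\le C\ln(K+1)/K$. (2) For all $0<b\le B$ there is $C>0$, depending only on $c_1,b,B$, such that for all $A,\sigma>0$ there is $\varepsilon_0>0$ such that for all $0<\varepsilon\le\varepsilon_0$ and all $K$ with $b\,\varepsilon^{-1/3}\le K\le B\,\varepsilon^{-1/3}$: the partition is benign with $w_k=N_k/n$ with probability at least $1-\delta$, and the algorithm is $(n',\varepsilon,\delta)$-certified for some $n'$ with $\rho=n'/n\le C\,\varepsilon^{1/3}\ln(1/\varepsilon)$. -/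

import Mathlib

open MeasureTheory ProbabilityTheory
open scoped ENNReal

noncomputable section

namespace CerEval

/-! ### Losses, partitions, benign partitions -/

/-- The loss `ℓ(f(X), Y)` of the model `f` as a function of the test point `(X, Y)`. -/
def loss {𝒳 𝒴 : Type*} (f : 𝒳 → 𝒴) (l : 𝒴 → 𝒴 → ℝ) (p : 𝒳 × 𝒴) : ℝ := l (f p.1) p.2

/-- The law of the loss has a density `h` with respect to Lebesgue measure, and
`h z ≥ A exp (-z² / σ²)` on `[0, 1]`. -/
def HasSuperGaussianLoss {E : Type*} [MeasurableSpace E] (P : Measure E) (Z : E → ℝ)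
    (A σ : ℝ) : Prop :=
  ∃ h : ℝ → ℝ, Measurable h ∧
    P.map Z = volume.withDensity (fun z => ENNReal.ofReal (h z)) ∧
    ∀ z ∈ Set.Icc (0 : ℝ) 1, A * Real.exp (-z ^ 2 / σ ^ 2) ≤ h z

/-- The `k`-th cell (`k = 0, …, K - 1`) of the equally spaced partition: the test points whose loss
lies in `[k / K, (k + 1) / K)`; the last cell also contains the right end point `1`. -/
def equalCell {E : Type*} (Z : E → ℝ) (K : ℕ) (k : Fin K) : Set E :=
  {p | (k : ℝ) / K ≤ Z p ∧ (Z p < ((k : ℝ) + 1) / K ∨ ((k : ℕ) + 1 = K ∧ Z p = 1))}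

/-- The variance of the loss conditioned on the `k`-th cell. -/
def cellVar {E : Type*} [MeasurableSpace E] (P : Measure E) (Z : E → ℝ) {K : ℕ}
    (A : Fin K → Set E) (k : Fin K) : ℝ :=
  variance Z (P[|A k])

/-- The condition defining a benign partition into `K` cells, where `w k` is the share of the
`k`-th cell and `v k` the conditional variance of the loss on it. -/
def IsBenign {K : ℕ} (w v : Fin K → ℝ) (ε : ℝ) : Prop :=
  ∀ k, Real.log ((K : ℝ) + 1) * max (v k) (ε ^ (2 / 3 : ℝ)) ≤ w k

/-- The tight sample complexity without extra knowledge, up to constant factors: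
`ε⁻² (ln (1/δ) + ln ln (1/ε))`. -/
def baseComplexity (ε δ : ℝ) : ℝ :=
  (Real.log (1 / δ) + Real.log (Real.log (1 / ε))) / ε ^ 2

/-! ### Online evaluation and certification -/

/-- What an online evaluation produces on one dataset: the number of evaluated test points at
termination, and for every round `t` the estimate and the radius of its confidence interval
(`⊤` for the trivial interval). After termination the last round is repeated. -/
structure Run where
  evaluated : ℕ
  estimate : ℕ → ℝ
  radius : ℕ → ℝ≥0∞

/-- `(n', ε, δ)`-certification for the true value `R`: with probability at least `1 - δ`, fewer
than `n'` test points are evaluated, the error level `ε` is attained, and every confidence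
interval produced contains `R`. -/
def IsCertified {Ω : Type*} [MeasurableSpace Ω] (μ : Measure Ω) (alg : Ω → Run) (R : ℝ)
    (n' : ℕ) (ε δ : ℝ) : Prop :=
  μ {ω | n' ≤ (alg ω).evaluated ∨ (∀ t, ENNReal.ofReal ε < (alg ω).radius t) ∨
      ∃ t, (alg ω).radius t < ENNReal.ofReal |(alg ω).estimate t - R|} ≤ ENNReal.ofReal δ

/-! ### The algorithm, run with a fixed partition `A` as its partition subroutine -/

/-- `η = √((2 ln (log₂ t + 1) + ln (16 K / δ)) / t)` for a group with `t` evaluated points. -/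
def eta (K : ℕ) (δ t : ℝ) : ℝ :=
  Real.sqrt ((2 * Real.log (Real.logb 2 t + 1) + Real.log (16 * (K : ℝ) / δ)) / t)

/-- The confidence radius `2 η² / 3 + 2 √((v + η + η²) η²)` of a group with empirical variance `v`
and `t` evaluated points. -/
def radiusFn (K : ℕ) (δ v t : ℝ) : ℝ :=
  2 * eta K δ t ^ 2 / 3 +
    2 * Real.sqrt ((v + eta K δ t + eta K δ t ^ 2) * eta K δ t ^ 2)

section Algorithm

variable {E : Type*} {n K : ℕ} (Z : E → ℝ) (A : Fin K → Set E) (δ : ℝ) (D : Fin n → E)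
  (S : Finset (Fin n))

open Classical in
/-- The points of the dataset `D` in the `k`-th cell. -/
def group (k : Fin K) : Finset (Fin n) := Finset.univ.filter fun i => D i ∈ A k

/-- The share `N_k / n` of the `k`-th cell in the dataset. -/
def share (k : Fin K) : ℝ := ((group A D k).card : ℝ) / n

/-- The evaluated points in the `k`-th cell, `S` being the set of all evaluated points. -/
def seen (k : Fin K) : Finset (Fin n) := S ∩ group A D k

/-- The empirical mean of the evaluated losses in the `k`-th cell. -/
def groupMean (k : Fin K) : ℝ :=
  (∑ i ∈ seen A D S k, Z (D i)) / (seen A D S k).card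

/-- The empirical variance of the evaluated losses in the `k`-th cell. -/
def groupVar (k : Fin K) : ℝ :=
  (∑ i ∈ seen A D S k, (Z (D i) - groupMean Z A D S k) ^ 2) / (seen A D S k).card

/-- The confidence radius of the `k`-th cell; it is infinite if no point of it is evaluated. -/
def groupRadius (k : Fin K) : ℝ≥0∞ :=
  if (seen A D S k).card = 0 then ⊤
  else ENNReal.ofReal (radiusFn K δ (groupVar Z A D S k) (seen A D S k).card)

/-- The performance estimate `∑ N_k R̂_k / n`. -/
def estimate : ℝ := ∑ k, share A D k * groupMean Z A D S k

/-- The overall confidence radius `∑ N_k ε_k / n`; a cell without data contributes `0 * ⊤ = 0`. -/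
def ciRadius : ℝ≥0∞ := ∑ k, ENNReal.ofReal (share A D k) * groupRadius Z A δ D S k

/-- The rate `(N_k / n) |∂ε_k / ∂n_k|` at which one more evaluation in the `k`-th cell reduces the
overall radius; it is infinite if no point of the cell is evaluated. -/
def priority (k : Fin K) : ℝ≥0∞ :=
  if (seen A D S k).card = 0 then ⊤
  else ENNReal.ofReal
    (share A D k * |deriv (radiusFn K δ (groupVar Z A D S k)) (seen A D S k).card|)

/-- The `k`-th cell has points that are not evaluated yet. -/
def IsAvailable (k : Fin K) : Prop := ∃ i, i ∉ S ∧ D i ∈ A k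

/-- The `k`-th cell has the largest priority among the available ones. -/
def IsTarget (k : Fin K) : Prop :=
  IsAvailable A D S k ∧ ∀ j, IsAvailable A D S j → priority Z A δ D S j ≤ priority Z A δ D S k

open Classical in
/-- The points that are not evaluated yet and belong to a target cell. -/
def candidates : Finset (Fin n) :=
  Finset.univ.filter fun i => i ∉ S ∧ ∃ k, IsTarget Z A δ D S k ∧ D i ∈ A k

/-- The evaluation stops when the error level `ε` is attained or all points are evaluated. -/
def IsDone (ε : ℝ) : Prop := ciRadius Z A δ D S ≤ ENNReal.ofReal ε ∨ S = Finset.univ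

open Classical in
/-- One round: unless the evaluation has stopped, evaluate the next point of a target cell (points
are used in the order of the dataset, which also breaks ties between target cells). -/
def step (ε : ℝ) : Finset (Fin n) :=
  if h : ¬ IsDone Z A δ D S ε ∧ (candidates Z A δ D S).Nonempty then
    insert ((candidates Z A δ D S).min' h.2) S
  else S

/-- The set of evaluated points after `t` rounds, starting from the first `m` points. -/
def evaluatedSet (ε : ℝ) (m : ℕ) : ℕ → Finset (Fin n)
  | 0 => Finset.univ.filter fun i => (i : ℕ) < m
  | t + 1 => step Z A δ D (evaluatedSet ε m t) ε

/-- The adaptive evaluation of the dataset `D` at error level `ε` and failure probability `δ`, with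
`m` warm start steps and with the cells `A` as its partition. Each round before the last one
evaluates a new point, so it has stopped after `n` rounds. -/
def cerEval (ε : ℝ) (m : ℕ) : Run where
  evaluated := (evaluatedSet Z A δ D ε m n).card
  estimate t := estimate Z A D (evaluatedSet Z A δ D ε m t)
  radius t := ciRadius Z A δ D (evaluatedSet Z A δ D ε m t)

end Algorithm

/-- `n'` is a number of test points for which the adaptive evaluation of an i.i.d. dataset of size
`n` from `P` with the equally spaced partition into `K` cells is `(n', ε, δ)`-certified. -/
def EqualCertified {E : Type*} [MeasurableSpace E] (P : Measure E) (Z : E → ℝ)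
    (K n m : ℕ) (ε δ : ℝ) (n' : ℕ) : Prop :=
  IsCertified (Measure.pi fun _ : Fin n => P)
    (fun D => cerEval Z (equalCell Z K) δ D ε m) (∫ p, Z p ∂P) n' ε δ

end CerEval

end

open MeasureTheory ProbabilityTheory
open scoped ENNReal

noncomputable section

namespace CerEval

/-! ### Maximal inequality for products of i.i.d. factors -/

/-! Write Q = ln(1/δ) + ln ln(1/ε), Λ = ln(K + 1), and let κ ≥ max(1/K², ε^(2/3)) bound the
variances inside the cells, which have width 1/K. About x = QΛκ/ε² points bring the radius of a cell
below ε/4 (`cellComplexity`, `radiusFn_le_quarter`). Over K cells this costs Kx points against n of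
order Q/ε², a ratio of order KκΛ (`Admissible.exists_equalCertified`). The density bound gives every
cell mass at least A exp(-1/σ²)/K, which is at least Λκ in both regimes; this yields benignity and
enough points in every cell. The choice κ = 1/K² gives the first rate, κ = max(1/K², ε^(2/3)) the
second.

Validity: the evaluated points of a cell are always an initial segment of the points of that cell
(`seen_eq_cellPrefix`), so adaptivity is harmless once the cell bound holds for all prefixes at
once. This is `cell_confidence`: Ville's inequality (`measure_crossing_le`) on dyadic scales,
applied to the deviation of the mean and to the lower tail of the squared deviations; the latter
lets the empirical variance replace the true one. The bound is proved with 19/20 of the radius. The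
spare 1/20 pays for the between-cell error, at most ε/40 with high probability
(`measure_abs_sum_share_sub_gt`), because the total radius never drops below ε/2
(`half_le_ciRadius`).

Cost: the cell radius has elasticity of order one in the number of points (`abs_deriv_radiusFn`), so
a priority is comparable to the contribution of the cell to the total radius divided by its number
of points. If a cell with x points is still the target, all less explored cells contribute little;
as the total exceeds ε, this bounds the size of the target by a multiple of Kx times its share
(`card_seen_le_of_isTarget`). Summation gives m + O(Kx) evaluations. -/

/-- The set of datasets on which some prefix sum of `φ` reaches the level `c`. -/
def crossing {E : Type*} (φ : E → ℝ) (n : ℕ) (c : ℝ) : Set (Fin n → E) :=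
  {D | ∃ i, i ≤ n ∧ c ≤ ∑ j : Fin n, if (j : ℕ) < i then φ (D j) else 0}

lemma measurableSet_crossing {E : Type*} [MeasurableSpace E] {φ : E → ℝ} (hφ : Measurable φ)
    (n : ℕ) (c : ℝ) : MeasurableSet (crossing φ n c) := by
  have : crossing φ n c = ⋃ i ∈ Set.Iic n,
      {D : Fin n → E | c ≤ ∑ j : Fin n, if (j : ℕ) < i then φ (D j) else 0} := by
    ext D; simp [crossing]
  rw [this]
  refine MeasurableSet.biUnion (Set.to_countable _) fun i _ => ?_
  refine measurableSet_le measurable_const (Finset.measurable_fun_sum _ fun j _ => ?_)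
  by_cases h : (j : ℕ) < i
  · simp only [h, if_true]; exact hφ.comp (measurable_pi_apply j)
  · simp only [h, if_false]; exact measurable_const

lemma cons_mem_crossing {E : Type*} {φ : E → ℝ} {n : ℕ} {c : ℝ} (hc : 0 < c) {x : E}
    {D : Fin n → E} (h : Fin.cons (α := fun _ => E) x D ∈ crossing φ (n + 1) c) :
    D ∈ crossing φ n (c - φ x) := by
  obtain ⟨i, hi, h⟩ := h
  rcases i with _ | i
  -- The empty prefix has sum 0 and cannot reach a positive level.
  · simp at h; linarith
  · refine ⟨i, by omega, ?_⟩
    rw [Fin.sum_univ_succ] at h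
    simp only [Fin.val_zero, Nat.zero_lt_succ, if_true, Fin.cons_zero, Fin.val_succ,
      Fin.cons_succ, Nat.add_lt_add_iff_right] at h
    linarith

/-- Ville's inequality: the products of exp(φ) along prefixes form a supermartingale started at 1.
The induction integrates out the first point x, after which the other points have to reach c - φ x.
-/
theorem measure_crossing_le {E : Type*} [MeasurableSpace E] (P : Measure E)
    [IsProbabilityMeasure P] {φ : E → ℝ} (hφ : Measurable φ)
    (h : ∫⁻ x, ENNReal.ofReal (Real.exp (φ x)) ∂P ≤ 1) (n : ℕ) (c : ℝ) :
    (Measure.pi fun _ : Fin n => P) (crossing φ n c) ≤ ENNReal.ofReal (Real.exp (-c)) := by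
  induction n generalizing c with
  | zero =>
    by_cases hc : c ≤ 0
    · refine prob_le_one.trans ?_
      rw [ENNReal.one_le_ofReal]
      exact Real.one_le_exp (by linarith)
    · have : crossing φ 0 c = ∅ := by
        ext D; simp [crossing]; linarith
      simp [this]
  | succ n ih =>
    by_cases hc : c ≤ 0
    · refine prob_le_one.trans ?_
      rw [ENNReal.one_le_ofReal]
      exact Real.one_le_exp (by linarith)
    push Not at hc
    have hm := measurableSet_crossing hφ (n + 1) c
    have mp := (measurePreserving_piFinSuccAbove (fun _ : Fin (n + 1) => P) 0).symm
    rw [← mp.measure_preimage hm.nullMeasurableSet,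
      Measure.prod_apply (mp.measurable hm)]
    calc _ ≤ ∫⁻ x, ENNReal.ofReal (Real.exp (-(c - φ x))) ∂P := by
          refine lintegral_mono fun x => (measure_mono ?_).trans (ih (c - φ x))
          intro D hD
          refine cons_mem_crossing hc ?_
          simpa [MeasurableEquiv.piFinSuccAbove, Fin.insertNthEquiv] using hD
      _ = ∫⁻ x, ENNReal.ofReal (Real.exp (-c)) * ENNReal.ofReal (Real.exp (φ x)) ∂P := by
          refine lintegral_congr fun x => ?_
          rw [← ENNReal.ofReal_mul (Real.exp_nonneg _), ← Real.exp_add]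
          congr 2; ring
      _ ≤ _ := by
          rw [lintegral_const_mul _ (by fun_prop)]
          exact mul_le_of_le_one_right' h

/-- A function that is bounded above by an affine one with mean at most one has an exponential
moment bound. -/
lemma lintegral_exp_le_one {E : Type*} [MeasurableSpace E] (P : Measure E)
    {φ g : E → ℝ} (hg : Integrable g P) (hle : ∀ᵐ x ∂P, Real.exp (φ x) ≤ g x)
    (h1 : ∫ x, g x ∂P ≤ 1) : ∫⁻ x, ENNReal.ofReal (Real.exp (φ x)) ∂P ≤ 1 := by
  calc _ ≤ ∫⁻ x, ENNReal.ofReal (g x) ∂P :=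
        lintegral_mono_ae (hle.mono fun x hx => ENNReal.ofReal_le_ofReal hx)
    _ = ENNReal.ofReal (∫ x, g x ∂P) := by
        rw [ofReal_integral_eq_lintegral_ofReal hg]
        exact hle.mono fun x hx => (Real.exp_nonneg _).trans hx
    _ ≤ 1 := by rw [← ENNReal.ofReal_one]; exact ENNReal.ofReal_le_ofReal h1

/-- The cubic Taylor remainder is at most (2/9)|x|³ ≤ (2/9)x², and 1/2 + 2/9 < 3/4. -/
lemma exp_le_quadratic {x : ℝ} (hx : |x| ≤ 1) : Real.exp x ≤ 1 + x + 3 / 4 * x ^ 2 := by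
  have h := Real.exp_bound hx (n := 3) (by norm_num)
  have h2 := (abs_le.mp h).2
  simp only [Finset.sum_range_succ, Finset.sum_range_zero, Nat.factorial] at h2
  have h3 : |x| ^ 3 ≤ x ^ 2 := by
    rw [← sq_abs]
    nlinarith [sq_nonneg (|x|), abs_nonneg x]
  norm_num at h2
  nlinarith

/-- (1 - x + x²/2)(1 + x + x²/2) = 1 + x⁴/4 ≥ 1, and the second factor is at most exp x. -/
lemma exp_neg_le_quadratic {x : ℝ} (hx : 0 ≤ x) : Real.exp (-x) ≤ 1 - x + x ^ 2 / 2 := by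
  have h := Real.quadratic_le_exp_of_nonneg hx
  rw [Real.exp_neg, inv_le_iff_one_le_mul₀ (Real.exp_pos x)]
  have : 0 ≤ 1 - x + x ^ 2 / 2 := by nlinarith [sq_nonneg (x - 1)]
  nlinarith [mul_le_mul_of_nonneg_left h this, sq_nonneg (x ^ 2)]

/-! ### Confidence bounds for one cell -/

/-- The mean of `Z` on the cell `A`. -/
def cellMean {E : Type*} [MeasurableSpace E] (P : Measure E) (Z : E → ℝ) (A : Set E) : ℝ :=
  (∫ x in A, Z x ∂P) / P.real A

/-- The variance of `Z` on the cell `A`. -/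
def cellVariance {E : Type*} [MeasurableSpace E] (P : Measure E) (Z : E → ℝ) (A : Set E) : ℝ :=
  (∫ x in A, (Z x - cellMean P Z A) ^ 2 ∂P) / P.real A

/-! ### Moments and exponential moments on a cell. -/

section Moments

variable {E : Type*} [MeasurableSpace E] {P : Measure E} [IsProbabilityMeasure P] {Z : E → ℝ}
  {A : Set E}

lemma integrable_of_mem_Icc (hZ : Measurable Z) (h01 : ∀ x, Z x ∈ Set.Icc (0 : ℝ) 1) :
    Integrable Z P :=
  Integrable.of_mem_Icc 0 1 hZ.aemeasurable (Filter.Eventually.of_forall h01)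

lemma cellMean_mem_Icc (hZ : Measurable Z) (h01 : ∀ x, Z x ∈ Set.Icc (0 : ℝ) 1)
    (hP : 0 < P.real A) : cellMean P Z A ∈ Set.Icc (0 : ℝ) 1 := by
  have hi := (integrable_of_mem_Icc (P := P) hZ h01).integrableOn (s := A)
  refine ⟨div_nonneg (integral_nonneg fun x => (h01 x).1) hP.le, ?_⟩
  rw [cellMean, div_le_one hP]
  calc _ ≤ ∫ x in A, (1 : ℝ) ∂P :=
        integral_mono hi (integrable_const _) fun x => (h01 x).2
    _ = _ := by simp

lemma setIntegral_sub_cellMean (hZ : Measurable Z) (h01 : ∀ x, Z x ∈ Set.Icc (0 : ℝ) 1)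
    (hP : 0 < P.real A) : ∫ x in A, (Z x - cellMean P Z A) ∂P = 0 := by
  have hi := (integrable_of_mem_Icc (P := P) hZ h01).integrableOn (s := A)
  rw [integral_sub hi (integrable_const _)]
  simp only [integral_const, MeasurableSet.univ, measureReal_restrict_apply, Set.univ_inter,
    smul_eq_mul]
  rw [cellMean]; field_simp; ring

lemma integrable_sq_sub (hZ : Measurable Z) (h01 : ∀ x, Z x ∈ Set.Icc (0 : ℝ) 1)
    {r : ℝ} (hr : r ∈ Set.Icc (0 : ℝ) 1) : Integrable (fun x => (Z x - r) ^ 2) P := by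
  refine Integrable.of_mem_Icc 0 1 (by fun_prop) (Filter.Eventually.of_forall fun x => ?_)
  obtain ⟨h0, h1⟩ := h01 x
  obtain ⟨h2, h3⟩ := hr
  exact ⟨sq_nonneg _, by nlinarith⟩

lemma cellVariance_nonneg {E : Type*} [MeasurableSpace E] {P : Measure E} {Z : E → ℝ}
    {A : Set E} : 0 ≤ cellVariance P Z A :=
  div_nonneg (integral_nonneg fun _ => sq_nonneg _) measureReal_nonneg

/-- Since Z² ≤ Z, the squared deviation has a majorant that is affine in Z, with conditional mean
r(1 - r). -/
lemma cellVariance_le (hZ : Measurable Z) (h01 : ∀ x, Z x ∈ Set.Icc (0 : ℝ) 1)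
    (hP : 0 < P.real A) : cellVariance P Z A ≤ 1 / 4 := by
  have hr := cellMean_mem_Icc hZ h01 hP
  set r := cellMean P Z A with hrdef
  have hi := (integrable_of_mem_Icc (P := P) hZ h01).integrableOn (s := A)
  have hi2 := (integrable_sq_sub (P := P) hZ h01 hr).integrableOn (s := A)
  have h0 := setIntegral_sub_cellMean hZ h01 hP
  rw [cellVariance, div_le_iff₀ hP, ← hrdef]
  rw [← hrdef] at h0
  have hs : IntegrableOn (fun x => Z x - r) A P := hi.sub (integrable_const _)
  calc _ ≤ ∫ x in A, (r * (1 - r) + (1 - 2 * r) * (Z x - r)) ∂P := by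
        refine integral_mono hi2 ((integrable_const _).add (hs.const_mul _)) fun x => ?_
        obtain ⟨h0, h1⟩ := h01 x
        show (Z x - r) ^ 2 ≤ r * (1 - r) + (1 - 2 * r) * (Z x - r)
        nlinarith
    _ = r * (1 - r) * P.real A := by
        have hc : ∫ x in A, r * (1 - r) ∂P = r * (1 - r) * P.real A := by
          rw [integral_const, measureReal_restrict_apply MeasurableSet.univ, Set.univ_inter,
            smul_eq_mul, mul_comm]
        rw [integral_add (integrable_const _) (hs.const_mul _), integral_const_mul (1 - 2 * r), h0,
          hc]
        ring
    _ ≤ _ := by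
        refine mul_le_mul_of_nonneg_right ?_ hP.le
        nlinarith [sq_nonneg (2 * r - 1)]

/-- Off the cell the exponent vanishes, so only conditional moments matter. The linear term of the
quadratic majorant averages to zero and leaves a + c·v. -/
lemma lintegral_exp_indicator_le_one (hA : MeasurableSet A) (hZ : Measurable Z)
    (h01 : ∀ x, Z x ∈ Set.Icc (0 : ℝ) 1) (hP : 0 < P.real A) {ψ : E → ℝ} {a b c : ℝ}
    (hψ : ∀ x, Real.exp (ψ x) ≤
      a + b * (Z x - cellMean P Z A) + c * (Z x - cellMean P Z A) ^ 2)
    (hac : a + c * cellVariance P Z A ≤ 1) :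
    ∫⁻ x, ENNReal.ofReal (Real.exp (A.indicator ψ x)) ∂P ≤ 1 := by
  have hr := cellMean_mem_Icc hZ h01 hP
  have h0 := setIntegral_sub_cellMean hZ h01 hP
  have hv : ∫ x in A, (Z x - cellMean P Z A) ^ 2 ∂P = cellVariance P Z A * P.real A := by
    rw [cellVariance]; field_simp
  set r := cellMean P Z A
  have hi := (integrable_of_mem_Icc (P := P) hZ h01)
  have hi2 := (integrable_sq_sub (P := P) hZ h01 hr)
  have hs : Integrable (fun x => Z x - r) P := hi.sub (integrable_const _)
  have hq1 : Integrable (fun x => (a - 1) + b * (Z x - r)) P :=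
    (integrable_const _).add (hs.const_mul _)
  have hq : Integrable (fun x => (a - 1) + b * (Z x - r) + c * (Z x - r) ^ 2) P :=
    hq1.add (hi2.const_mul _)
  refine lintegral_exp_le_one P
    (g := fun x => 1 + A.indicator (fun x => (a - 1) + b * (Z x - r) + c * (Z x - r) ^ 2) x)
    ((integrable_const _).add (hq.indicator hA)) (Filter.Eventually.of_forall fun x => ?_) ?_
  · by_cases hx : x ∈ A
    · simp only [Set.indicator_of_mem hx]; linarith [hψ x]
    · simp [Set.indicator_of_notMem hx]
  · rw [integral_add (integrable_const _) (hq.indicator hA), integral_indicator hA,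
      integral_add hq1.integrableOn (hi2.const_mul c).integrableOn,
      integral_add (integrable_const _) (hs.const_mul b).integrableOn, integral_const_mul,
      integral_const_mul, h0, hv]
    simp only [integral_const, MeasurableSet.univ, measureReal_restrict_apply, Set.univ_inter,
      smul_eq_mul, probReal_univ]
    nlinarith

lemma lintegral_exp_mean (hA : MeasurableSet A) (hZ : Measurable Z)
    (h01 : ∀ x, Z x ∈ Set.Icc (0 : ℝ) 1) (hP : 0 < P.real A) {l : ℝ} (hl : |l| ≤ 1) :
    ∫⁻ x, ENNReal.ofReal (Real.exp (A.indicator (fun x => l * (Z x - cellMean P Z A) -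
      3 / 4 * l ^ 2 * cellVariance P Z A) x)) ∂P ≤ 1 := by
  have hr := cellMean_mem_Icc hZ h01 hP
  set q := 3 / 4 * l ^ 2 * cellVariance P Z A with hq
  refine lintegral_exp_indicator_le_one hA hZ h01 hP (a := Real.exp (-q))
    (b := Real.exp (-q) * l) (c := Real.exp (-q) * (3 / 4 * l ^ 2)) (fun x => ?_) ?_
  · have h1 : |l * (Z x - cellMean P Z A)| ≤ 1 := by
      rw [abs_mul]
      refine mul_le_one₀ hl (abs_nonneg _) ?_
      obtain ⟨h0, h1⟩ := h01 x
      exact abs_le.mpr ⟨by linarith [hr.2], by linarith [hr.1]⟩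
    have h2 := mul_le_mul_of_nonneg_left (exp_le_quadratic h1) (Real.exp_nonneg (-q))
    rw [← Real.exp_add] at h2
    calc _ = Real.exp (-q + l * (Z x - cellMean P Z A)) := by congr 1; ring
      _ ≤ _ := h2.trans (le_of_eq (by ring))
  · calc _ = Real.exp (-q) * (q + 1) := by rw [hq]; ring
      _ ≤ Real.exp (-q) * Real.exp q :=
        mul_le_mul_of_nonneg_left (Real.add_one_le_exp q) (Real.exp_nonneg _)
      _ = 1 := by rw [← Real.exp_add]; simp

/-- Serves to show that the true variance cannot exceed the empirical one by much. The second-order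
bound closes because the fourth power of a deviation is at most its square. -/
lemma lintegral_exp_variance (hA : MeasurableSet A) (hZ : Measurable Z)
    (h01 : ∀ x, Z x ∈ Set.Icc (0 : ℝ) 1) (hP : 0 < P.real A) {θ : ℝ} (hθ : 0 ≤ θ) :
    ∫⁻ x, ENNReal.ofReal (Real.exp (A.indicator (fun x => (θ - θ ^ 2 / 2) * cellVariance P Z A -
      θ * (Z x - cellMean P Z A) ^ 2) x)) ∂P ≤ 1 := by
  have hr := cellMean_mem_Icc hZ h01 hP
  set q := (θ - θ ^ 2 / 2) * cellVariance P Z A with hq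
  refine lintegral_exp_indicator_le_one hA hZ h01 hP (a := Real.exp q)
    (b := 0) (c := Real.exp q * (-(θ - θ ^ 2 / 2))) (fun x => ?_) ?_
  · obtain ⟨h0, h1⟩ := h01 x
    have h3 : (Z x - cellMean P Z A) ^ 2 ≤ 1 := by nlinarith [hr.1, hr.2]
    have h4 := sq_nonneg (Z x - cellMean P Z A)
    have h2 := mul_le_mul_of_nonneg_left
      (exp_neg_le_quadratic (mul_nonneg hθ h4)) (Real.exp_nonneg q)
    rw [← Real.exp_add] at h2
    calc _ = Real.exp (q + -(θ * (Z x - cellMean P Z A) ^ 2)) := by congr 1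
      _ ≤ _ := h2.trans ?_
    have h5 : (θ * (Z x - cellMean P Z A) ^ 2) ^ 2 ≤ θ ^ 2 * (Z x - cellMean P Z A) ^ 2 := by
      rw [mul_pow]
      exact mul_le_mul_of_nonneg_left (by nlinarith) (sq_nonneg θ)
    have := Real.exp_pos q
    nlinarith
  · calc _ = Real.exp q * (-q + 1) := by rw [hq]; ring
      _ ≤ Real.exp q * Real.exp (-q) :=
        mul_le_mul_of_nonneg_left (Real.add_one_le_exp (-q)) (Real.exp_nonneg _)
      _ = 1 := by rw [← Real.exp_add]; simp

end Moments

-- With s = √v, the tilt l = h/s gives |d| ≤ (u² + 3h²/4)s/h. Then `h3` gives v ≤ w + u + u², which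
-- replaces s by an empirical quantity.
set_option maxHeartbeats 400000 in
lemma abs_le_of_large_variance {L t v w d h l u : ℝ} (ht : 0 < t) (hu0 : 0 < u)
    (hhu : h ^ 2 ≤ 2 * u ^ 2) (huh : u ≤ h) (hvp : 0 < v) (hv : v ≤ 1 / 4)
    (hl : l = h / Real.sqrt v) (hu2 : u ^ 2 * t = L)
    (hd : l * |d| ≤ u ^ 2 + 3 / 4 * l ^ 2 * v)
    (h3 : (2 * h - (2 * h) ^ 2 / 2) * v * t - 2 * h * (t * (w + d ^ 2)) < L) :
    |d| ≤ 19 / 20 * (2 * u ^ 2 / 3 + 2 * (Real.sqrt (w + u + u ^ 2) * u)) := by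
  have hh0 : 0 < h := hu0.trans_le huh
  have hv0 := hvp.le
  set s := Real.sqrt v with hs
  have hs0 : 0 < s := Real.sqrt_pos.mpr hvp
  have hs2 : s ^ 2 = v := Real.sq_sqrt hv0
  have hsl : l * s = h := by rw [hl]; field_simp
  have hhu' : h ≤ 142 / 100 * u := by
    refine abs_le_of_sq_le_sq' ?_ (by positivity) |>.2
    nlinarith
  -- With h = yu and 1 ≤ y ≤ 1.42, the convex function 1/y + 3y/4 is at most 1.77 at both ends; 1.77
  -- < 2 · 19/20 is the slack needed.
  have hy : u ^ 2 + 3 / 4 * h ^ 2 ≤ 177 / 100 * (u * h) := by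
    nlinarith
  have hd1 : |d| ≤ 177 / 100 * (u * s) := by
    have : h * |d| ≤ h * (177 / 100 * (u * s)) := by
      have e1 : h * |d| = s * (l * |d|) := by rw [← hsl]; ring
      have e2 : l ^ 2 * v = h ^ 2 := by rw [← hsl, ← hs2]; ring
      have e3 : s * (l * |d|) ≤ s * (u ^ 2 + 3 / 4 * h ^ 2) :=
        mul_le_mul_of_nonneg_left (by linarith) hs0.le
      nlinarith
    exact le_of_mul_le_mul_left this hh0
  have hs1 : s ≤ 1 / 2 := by
    refine abs_le_of_sq_le_sq' ?_ (by norm_num) |>.2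
    nlinarith
  have hdsq : d ^ 2 ≤ u ^ 2 := by
    rw [← sq_abs d]
    have : |d| ≤ u := by nlinarith
    exact pow_le_pow_left₀ (abs_nonneg d) this 2
  -- Division of `h3` by 2ht leaves v - w - d² < u²/(2h) + hv ≤ u/2 + h/4 ≤ u, and d² ≤ u².
  have hvw : v ≤ w + u + u ^ 2 := by
    have e1 : t * (2 * h * v - 2 * h ^ 2 * v - 2 * h * (w + d ^ 2)) < t * u ^ 2 := by
      linarith
    have e2 := lt_of_mul_lt_mul_left e1 ht.le
    have e3 : h * v ≤ h / 4 := by nlinarith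
    have e6 : 0 ≤ (h - u) * (142 / 100 * u - h) :=
      mul_nonneg (by linarith) (by linarith)
    have e7 : u * u ≤ h * u := mul_le_mul_of_nonneg_right huh hu0.le
    have e8 : h * (h * v) ≤ h * (h / 4) := mul_le_mul_of_nonneg_left e3 hh0.le
    have e4 : 2 * h * (v - w - d ^ 2) ≤ 2 * h * u := by linarith
    have e5 : v - w - d ^ 2 ≤ u := le_of_mul_le_mul_left e4 (by positivity)
    linarith
  have hsW : s ≤ Real.sqrt (w + u + u ^ 2) := Real.sqrt_le_sqrt hvw
  have h4 := mul_le_mul_of_nonneg_left hsW hu0.le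
  have h5 := mul_nonneg hu0.le hs0.le
  linarith [sq_nonneg u]

/-- The deterministic core of the confidence bound: `d` is the deviation of the mean, `w` the
empirical variance, and `v` the true variance. -/
lemma abs_le_of_subexponential {L T t v w d h l : ℝ} (hL : 0 < L) (hT : 0 < T) (hTt : T ≤ t)
    (htT : t ≤ 2 * T) (hv : v ≤ 1 / 4) (hw : 0 ≤ w) (hh : h = Real.sqrt (L / T))
    (hl : l = h / Real.sqrt (max v (h ^ 2)))
    (h1 : l * (t * d) - 3 / 4 * l ^ 2 * v * t < L)
    (h2 : -l * (t * d) - 3 / 4 * l ^ 2 * v * t < L)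
    (h3 : (2 * h - (2 * h) ^ 2 / 2) * v * t - 2 * h * (t * (w + d ^ 2)) < L)
    {u : ℝ} (hu : u = Real.sqrt (L / t)) :
    |d| ≤ 19 / 20 * (2 * u ^ 2 / 3 + 2 * Real.sqrt ((w + u + u ^ 2) * u ^ 2)) := by
  have ht : 0 < t := hT.trans_le hTt
  have hu0 : 0 < u := hu ▸ Real.sqrt_pos.mpr (div_pos hL ht)
  have hh0 : 0 < h := hh ▸ Real.sqrt_pos.mpr (div_pos hL hT)
  have hu2 : u ^ 2 * t = L := by rw [hu, Real.sq_sqrt (div_pos hL ht).le]; field_simp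
  have hh2 : h ^ 2 * T = L := by rw [hh, Real.sq_sqrt (div_pos hL hT).le]; field_simp
  have huh : u ≤ h := by
    rw [hu, hh]; exact Real.sqrt_le_sqrt (div_le_div_of_nonneg_left hL.le hT hTt)
  have hhu : h ^ 2 ≤ 2 * u ^ 2 := by
    have : h ^ 2 * T ≤ 2 * u ^ 2 * T := by nlinarith [sq_nonneg u]
    exact le_of_mul_le_mul_right this hT
  have hm : 0 < max v (h ^ 2) := lt_max_of_lt_right (by positivity)
  have hl0 : 0 < l := hl ▸ div_pos hh0 (Real.sqrt_pos.mpr hm)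
  have hd : l * |d| ≤ u ^ 2 + 3 / 4 * l ^ 2 * v := by
    have : t * (l * |d|) ≤ t * (u ^ 2 + 3 / 4 * l ^ 2 * v) := by
      rcases abs_cases d with ⟨he, _⟩ | ⟨he, _⟩ <;> rw [he] <;> nlinarith
    exact le_of_mul_le_mul_left this ht
  rw [Real.sqrt_mul (by positivity), Real.sqrt_sq hu0.le]
  rcases le_or_gt v (h ^ 2) with hvh | hvh
  -- At small variance |d| ≤ u² + (3/4)h² ≤ (5/2)u², while the right side is at least (19/20)(2/3 +
  -- 2)u² = (38/15)u².
  · have : l = 1 := by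
      rw [hl, max_eq_right hvh, Real.sqrt_sq hh0.le]; exact div_self hh0.ne'
    subst this
    have : u ≤ Real.sqrt (w + u + u ^ 2) := Real.le_sqrt_of_sq_le (by linarith)
    nlinarith
  · rw [max_eq_left hvh.le] at hl
    have hvp : 0 < v := lt_of_le_of_lt (sq_nonneg h) hvh
    exact abs_le_of_large_variance ht hu0 hhu huh hvp hv hl hu2 hd h3

/-! ### Empirical mean and variance of a finite sample. -/

section Empirical

variable {E : Type*} {n : ℕ} (Z : E → ℝ) (D : Fin n → E) (s : Finset (Fin n))

/-- The mean of the losses of the points in `s`. -/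
def empMean : ℝ := (∑ i ∈ s, Z (D i)) / s.card

/-- The variance of the losses of the points in `s`. -/
def empVar : ℝ := (∑ i ∈ s, (Z (D i) - empMean Z D s) ^ 2) / s.card

lemma empVar_nonneg : 0 ≤ empVar Z D s :=
  div_nonneg (Finset.sum_nonneg fun _ _ => sq_nonneg _) (Nat.cast_nonneg _)

variable {s}

lemma sum_sub_eq (hs : s.card ≠ 0) (r : ℝ) :
    ∑ i ∈ s, (Z (D i) - r) = s.card * (empMean Z D s - r) := by
  have : (s.card : ℝ) ≠ 0 := by exact_mod_cast hs
  rw [Finset.sum_sub_distrib, Finset.sum_const, nsmul_eq_mul, empMean]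
  field_simp

lemma sum_sq_sub_eq (hs : s.card ≠ 0) (r : ℝ) :
    ∑ i ∈ s, (Z (D i) - r) ^ 2 = s.card * (empVar Z D s + (empMean Z D s - r) ^ 2) := by
  have hc : (s.card : ℝ) ≠ 0 := by exact_mod_cast hs
  have h0 : ∑ i ∈ s, (Z (D i) - empMean Z D s) = 0 := by rw [sum_sub_eq Z D hs]; simp
  have h1 : ∑ i ∈ s, (Z (D i) - r) ^ 2 = ∑ i ∈ s, ((Z (D i) - empMean Z D s) ^ 2 +
      2 * (empMean Z D s - r) * (Z (D i) - empMean Z D s) + (empMean Z D s - r) ^ 2) :=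
    Finset.sum_congr rfl fun i _ => by ring
  rw [h1, Finset.sum_add_distrib, Finset.sum_add_distrib, ← Finset.mul_sum, h0, empVar]
  simp only [Finset.sum_const, nsmul_eq_mul]
  field_simp
  ring

end Empirical

open Classical in
/-- The points of the cell `A` among the first `i` points of the dataset. -/
def cellPrefix {E : Type*} {n : ℕ} (A : Set E) (D : Fin n → E) (i : ℕ) : Finset (Fin n) :=
  Finset.univ.filter fun j => (j : ℕ) < i ∧ D j ∈ A

lemma sum_indicator_eq_sum_cellPrefix {E : Type*} {n : ℕ} (A : Set E) (D : Fin n → E) (i : ℕ)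
    (ψ : E → ℝ) : (∑ j : Fin n, if (j : ℕ) < i then A.indicator ψ (D j) else 0) =
      ∑ j ∈ cellPrefix A D i, ψ (D j) := by
  classical
  rw [cellPrefix, Finset.sum_filter]
  refine Finset.sum_congr rfl fun j _ => ?_
  by_cases h1 : (j : ℕ) < i <;> by_cases h2 : D j ∈ A <;> simp [h1, h2]

/-- The confidence exponent `2 ln (log₂ t + 1) + ln (16 K / δ)`. -/
def confExp (K : ℕ) (δ t : ℝ) : ℝ :=
  2 * Real.log (Real.logb 2 t + 1) + Real.log (16 * (K : ℝ) / δ)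

lemma eta_eq (K : ℕ) (δ t : ℝ) : eta K δ t = Real.sqrt (confExp K δ t / t) := rfl

lemma sum_inv_sq_le (n : ℕ) : ∑ j ∈ Finset.range n, (1 : ℝ) / ((j : ℝ) + 1) ^ 2 ≤ (2 : ℝ) := by
  have : ∀ n : ℕ, ∑ j ∈ Finset.range (n + 1), (1 : ℝ) / ((j : ℝ) + 1) ^ 2 ≤
      (2 : ℝ) - 1 / ((n : ℝ) + 1) := by
    intro n
    induction n with
    | zero => norm_num
    | succ n ih =>
      rw [Finset.sum_range_succ]
      have : (1 : ℝ) / ((n + 1 : ℕ) + 1) ^ 2 ≤ 1 / ((n : ℝ) + 1) - 1 / ((n + 1 : ℕ) + 1) := by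
        push_cast
        rw [div_sub_div _ _ (by positivity) (by positivity),
          div_le_div_iff₀ (by positivity) (by positivity)]
        nlinarith [(Nat.cast_nonneg n : (0 : ℝ) ≤ n)]
      linarith
  rcases n with _ | n
  · simp
  · exact (this n).trans (by have : (0 : ℝ) ≤ 1 / ((n : ℝ) + 1) := by positivity
                             linarith)

lemma two_le_log_sixteen_mul {K : ℕ} (hK : 1 ≤ K) {δ : ℝ} (hδ : 0 < δ) (hδ1 : δ ≤ 1) :
    2 ≤ Real.log (16 * (K : ℝ) / δ) := by
  have hK' : (1 : ℝ) ≤ K := by exact_mod_cast hK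
  have h1 : Real.log 16 ≤ Real.log (16 * (K : ℝ) / δ) := by
    refine Real.log_le_log (by norm_num) ?_
    rw [le_div_iff₀ hδ]; nlinarith
  have h2 : Real.log 16 = 4 * Real.log 2 := by
    rw [show (16 : ℝ) = 2 ^ 4 by norm_num, Real.log_pow]; norm_num
  linarith [Real.log_two_gt_d9]

lemma radius_mono {w u x : ℝ} (hw : 0 ≤ w) (hu : 0 ≤ u) (hux : u ≤ x) :
    2 * u ^ 2 / 3 + 2 * Real.sqrt ((w + u + u ^ 2) * u ^ 2) ≤
      2 * x ^ 2 / 3 + 2 * Real.sqrt ((w + x + x ^ 2) * x ^ 2) := by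
  have hx := hu.trans hux
  have h2 : u ^ 2 ≤ x ^ 2 := pow_le_pow_left₀ hu hux 2
  gcongr

/-- Peeling over the dyadic ranges 2^j ≤ t < 2^(j+1) of the number t of points: on each of them
fixed tilts are optimal up to constants, and three crossing events have total probability at most
3δ/(16K(j+1)²). The inverse squares sum to at most 2. -/
theorem cell_confidence {E : Type*} [MeasurableSpace E] {P : Measure E} [IsProbabilityMeasure P]
    {Z : E → ℝ} {A : Set E} (hA : MeasurableSet A) (hZ : Measurable Z)
    (h01 : ∀ x, Z x ∈ Set.Icc (0 : ℝ) 1) (hP : 0 < P.real A) {K : ℕ} (hK : 1 ≤ K) {δ : ℝ}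
    (hδ : 0 < δ) (hδ1 : δ ≤ 1) (n : ℕ) :
    (Measure.pi fun _ : Fin n => P) {D | ∃ i, (cellPrefix A D i).card ≠ 0 ∧
      19 / 20 * radiusFn K δ (empVar Z D (cellPrefix A D i)) (cellPrefix A D i).card <
        |empMean Z D (cellPrefix A D i) - cellMean P Z A|} ≤
      ENNReal.ofReal (3 * δ / (8 * K)) := by
  have hK' : (1 : ℝ) ≤ K := by exact_mod_cast hK
  set r := cellMean P Z A with hr
  set v := cellVariance P Z A with hv
  have hv0 : 0 ≤ v := cellVariance_nonneg
  have hv1 : v ≤ 1 / 4 := cellVariance_le hZ h01 hP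
  set L : ℕ → ℝ := fun j => 2 * Real.log ((j : ℝ) + 1) + Real.log (16 * (K : ℝ) / δ) with hLdef
  have hL : ∀ j, 0 < L j := fun j => by
    have := two_le_log_sixteen_mul hK hδ hδ1
    have := Real.log_nonneg (show (1 : ℝ) ≤ (j : ℝ) + 1 by linarith [(Nat.cast_nonneg j : (0:ℝ) ≤ j)])
    simp only [hLdef]; linarith
  have hexp : ∀ j, Real.exp (-L j) = δ / (16 * K) * (1 / ((j : ℝ) + 1) ^ 2) := fun j => by
    simp only [hLdef]
    rw [neg_add, Real.exp_add, Real.exp_neg, Real.exp_neg, Real.exp_log (by positivity), two_mul,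
      Real.exp_add, Real.exp_log (by positivity)]
    field_simp
  set h : ℕ → ℝ := fun j => Real.sqrt (L j / 2 ^ j) with hh
  -- The Bernstein tilt √(L/(2^j v)), capped at 1, where the quadratic bound for the exponential
  -- ends.
  set l : ℕ → ℝ := fun j => h j / Real.sqrt (max v (h j ^ 2)) with hl
  have hh0 : ∀ j, 0 < h j := fun j => Real.sqrt_pos.mpr (div_pos (hL j) (by positivity))
  have hl0 : ∀ j, 0 ≤ l j := fun j => div_nonneg (hh0 j).le (Real.sqrt_nonneg _)
  have hl1 : ∀ j, l j ≤ 1 := fun j => by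
    have : h j ≤ Real.sqrt (max v (h j ^ 2)) := Real.le_sqrt_of_sq_le (le_max_right _ _)
    exact div_le_one_of_le₀ this (Real.sqrt_nonneg _)
  set φ₁ : ℕ → ℝ → E → ℝ := fun j e x => e * l j * (Z x - r) - 3 / 4 * (e * l j) ^ 2 * v
  set φ₂ : ℕ → E → ℝ := fun j x => (2 * h j - (2 * h j) ^ 2 / 2) * v - 2 * h j * (Z x - r) ^ 2
  have hm₁ : ∀ j e, Measurable (A.indicator (φ₁ j e)) := fun j e =>
    Measurable.indicator (by fun_prop) hA
  have hm₂ : ∀ j, Measurable (A.indicator (φ₂ j)) := fun j =>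
    Measurable.indicator (by fun_prop) hA
  have hb₁ : ∀ j e, |e| = 1 → (Measure.pi fun _ : Fin n => P)
      (crossing (A.indicator (φ₁ j e)) n (L j)) ≤ ENNReal.ofReal (Real.exp (-L j)) := by
    intro j e he
    refine measure_crossing_le P (hm₁ j e) (lintegral_exp_mean hA hZ h01 hP ?_) n _
    rw [abs_mul, he, one_mul, abs_of_nonneg (hl0 j)]; exact hl1 j
  have hb₂ : ∀ j, (Measure.pi fun _ : Fin n => P)
      (crossing (A.indicator (φ₂ j)) n (L j)) ≤ ENNReal.ofReal (Real.exp (-L j)) := fun j =>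
    measure_crossing_le P (hm₂ j) (lintegral_exp_variance hA hZ h01 hP
      (by linarith [hh0 j] : 0 ≤ 2 * h j)) n _
  calc _ ≤ (Measure.pi fun _ : Fin n => P) (⋃ j ∈ Finset.range n,
        (crossing (A.indicator (φ₁ j 1)) n (L j) ∪ crossing (A.indicator (φ₁ j (-1))) n (L j) ∪
          crossing (A.indicator (φ₂ j)) n (L j))) := by
        refine measure_mono ?_
        rintro D ⟨i, hc, hD⟩
        -- `crossing` admits only prefixes of length at most n.
        have hi : cellPrefix A D i = cellPrefix A D (min i n) := by
          ext j; simp [cellPrefix]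
        set s := cellPrefix A D i with hs
        have hcn : s.card ≤ n := by
          have := Finset.card_le_univ s; simpa using this
        set j := Nat.log 2 s.card with hj
        have hj1 : 2 ^ j ≤ s.card := Nat.pow_log_le_self 2 hc
        have hj2 : s.card < 2 ^ (j + 1) := Nat.lt_pow_succ_log_self (by norm_num) _
        have hjn : j < n := (Nat.log_lt_self 2 hc).trans_le hcn
        refine Set.mem_biUnion (x := j) (by simpa using hjn) ?_
        by_contra hcon
        simp only [Set.mem_union, not_or] at hcon
        obtain ⟨⟨hcon1, hcon2⟩, hcon3⟩ := hcon
        have key : ∀ ψ : E → ℝ, D ∉ crossing (A.indicator ψ) n (L j) →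
            ∑ q ∈ s, ψ (D q) < L j := fun ψ hψ => by
          by_contra hge
          refine hψ ⟨min i n, min_le_right _ _, ?_⟩
          rw [sum_indicator_eq_sum_cellPrefix, ← hi]
          exact not_lt.mp hge
        have k1 := key _ hcon1
        have k2 := key _ hcon2
        have k3 := key _ hcon3
        simp only [φ₁, φ₂, Finset.sum_sub_distrib, ← Finset.mul_sum, Finset.sum_const,
          nsmul_eq_mul, sum_sq_sub_eq Z D hc] at k1 k2 k3
        have e0 : ∑ x ∈ s, Z (D x) - s.card * r = s.card * (empMean Z D s - r) := by
          rw [← sum_sub_eq Z D hc, Finset.sum_sub_distrib, Finset.sum_const, nsmul_eq_mul]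
        rw [e0] at k1 k2
        have hj1' : (2 : ℝ) ^ j ≤ s.card := by exact_mod_cast hj1
        have hj2' : (s.card : ℝ) ≤ 2 * 2 ^ j := by
          have : (s.card : ℝ) < 2 ^ (j + 1) := by exact_mod_cast hj2
          rw [pow_succ] at this; linarith
        have hcard : (0 : ℝ) < s.card := lt_of_lt_of_le (by positivity) hj1'
        have main := abs_le_of_subexponential (hL j) (by positivity : (0 : ℝ) < 2 ^ j) hj1' hj2'
          hv1 (empVar_nonneg Z D s) (d := empMean Z D s - r) (h := h j) (l := l j) rfl rfl
          (by linarith) (by linarith) (by linarith) rfl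
        refine absurd hD (not_lt.mpr (main.trans ?_))
        refine mul_le_mul_of_nonneg_left ?_ (by norm_num)
        refine radius_mono (empVar_nonneg Z D s) (Real.sqrt_nonneg _) ?_
        rw [eta_eq]
        refine Real.sqrt_le_sqrt (div_le_div_of_nonneg_right ?_ hcard.le)
        simp only [hLdef, confExp]
        -- Because of j ≤ log₂ t the exponent of the dyadic scale is dominated by that of the
        -- algorithm.
        have hlog : (j : ℝ) ≤ Real.logb 2 s.card := by
          rw [Real.le_logb_iff_rpow_le (by norm_num) hcard]
          simpa using hj1'
        have := Real.log_le_log (by positivity) (by linarith : (j : ℝ) + 1 ≤ Real.logb 2 s.card + 1)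
        linarith
    _ ≤ ∑ j ∈ Finset.range n, ENNReal.ofReal (3 * (δ / (16 * K) * (1 / ((j : ℝ) + 1) ^ 2))) := by
        refine (measure_biUnion_finset_le _ _).trans (Finset.sum_le_sum fun j _ => ?_)
        refine (measure_union_le _ _).trans ((add_le_add_left (measure_union_le _ _) _).trans ?_)
        refine (add_le_add (add_le_add (hb₁ j 1 (by simp)) (hb₁ j (-1) (by simp)))
          (hb₂ j)).trans ?_
        have hp : 0 ≤ δ / (16 * K) * (1 / ((j : ℝ) + 1) ^ 2) := by positivity
        rw [hexp, ← ENNReal.ofReal_add hp hp, ← ENNReal.ofReal_add (by linarith) hp]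
        exact ENNReal.ofReal_le_ofReal (by linarith)
    _ = ENNReal.ofReal (∑ j ∈ Finset.range n, 3 * (δ / (16 * K) * (1 / ((j : ℝ) + 1) ^ 2))) :=
        (ENNReal.ofReal_sum_of_nonneg fun j _ => by positivity).symm
    _ ≤ _ := by
        refine ENNReal.ofReal_le_ofReal ?_
        rw [← Finset.mul_sum, ← Finset.mul_sum]
        have := mul_le_mul_of_nonneg_left (sum_inv_sq_le n)
          (by positivity : 0 ≤ 3 * (δ / (16 * (K : ℝ))))
        calc _ = 3 * (δ / (16 * (K : ℝ))) * ∑ i ∈ Finset.range n, 1 / ((i : ℝ) + 1) ^ 2 := by ring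
          _ ≤ _ := this
          _ = _ := by field_simp; norm_num

/-! ### Analysis of the confidence radius -/

/-- The confidence radius as a function of the squared rate `q = η²`. -/
def radiusOf (v q : ℝ) : ℝ := 2 * q / 3 + 2 * Real.sqrt ((v + Real.sqrt q + q) * q)

lemma radiusFn_eq {K : ℕ} {δ v t : ℝ} (h : 0 ≤ confExp K δ t / t) :
    radiusFn K δ v t = radiusOf v (confExp K δ t / t) := by
  rw [radiusFn, eta_eq, radiusOf, Real.sq_sqrt h]

lemma radiusOf_nonneg {v q : ℝ} (hq : 0 ≤ q) : 0 ≤ radiusOf v q := by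
  rw [radiusOf]; positivity

lemma two_mul_le_radiusOf {v q : ℝ} (hv : 0 ≤ v) (hq : 0 ≤ q) : 2 * q ≤ radiusOf v q := by
  have : q ≤ Real.sqrt ((v + Real.sqrt q + q) * q) := by
    refine Real.le_sqrt_of_sq_le ?_
    nlinarith [Real.sqrt_nonneg q, mul_nonneg hv hq, mul_nonneg (Real.sqrt_nonneg q) hq]
  rw [radiusOf]; linarith

lemma radiusOf_half_le {v q w p : ℝ} (hv : 0 ≤ v) (hq : 0 ≤ q) (hw : v / 2 ≤ w) (hp : q / 2 ≤ p) :
    radiusOf v q / 2 ≤ radiusOf w p := by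
  have hs : Real.sqrt q / 2 ≤ Real.sqrt p := by
    refine Real.le_sqrt_of_sq_le ?_
    rw [div_pow, Real.sq_sqrt hq]; linarith
  have : Real.sqrt ((v + Real.sqrt q + q) * q) / 2 ≤ Real.sqrt ((w + Real.sqrt p + p) * p) := by
    refine Real.le_sqrt_of_sq_le ?_
    rw [div_pow, Real.sq_sqrt (by positivity)]
    calc _ = ((v + Real.sqrt q + q) / 2) * (q / 2) := by ring
      _ ≤ _ := mul_le_mul (by linarith) hp (by linarith)
        (by linarith [Real.sqrt_nonneg p])
  rw [radiusOf, radiusOf]; linarith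

/-- The elasticity in q lies in [1/2, 1]: under the root are monomials of degrees 1, 3/2 and 2,
outside it a linear term. -/
lemma hasDerivAt_radiusOf {v q : ℝ} (hv : 0 ≤ v) (hq : 0 < q) :
    ∃ F : ℝ, HasDerivAt (radiusOf v) F q ∧ radiusOf v q / 2 ≤ q * F ∧ q * F ≤ radiusOf v q := by
  have hs : 0 < Real.sqrt q := Real.sqrt_pos.mpr hq
  have hG : 0 < (v + Real.sqrt q + q) * q := by positivity
  have h1 : HasDerivAt (fun q => (v + Real.sqrt q + q) * q)
      ((1 / (2 * Real.sqrt q) + 1) * q + (v + Real.sqrt q + q) * 1) q :=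
    (((Real.hasDerivAt_sqrt hq.ne').const_add v).add (hasDerivAt_id q)).mul (hasDerivAt_id q)
  have h2 := (((hasDerivAt_id q).const_mul 2).div_const 3).add ((h1.sqrt hG.ne').const_mul 2)
  refine ⟨_, h2, ?_⟩
  have hss : Real.sqrt q * Real.sqrt q = q := Real.mul_self_sqrt hq.le
  set s := Real.sqrt q
  set R := Real.sqrt ((v + s + q) * q) with hR
  have hR0 : 0 < R := Real.sqrt_pos.mpr hG
  have hRR : R * R = (v + s + q) * q := Real.mul_self_sqrt hG.le
  have e : q * (2 * 1 / 3 + 2 * (((1 / (2 * s) + 1) * q + (v + s + q) * 1) / (2 * R))) =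
      2 * q / 3 + (s * q / 2 + q * q + R * R) / R := by
    rw [hRR]
    field_simp
    rw [← hss]; ring
  have e2 : radiusOf v q = 2 * q / 3 + 2 * R := rfl
  rw [e, e2]
  have hsq := mul_pos hs hq
  have hvq := mul_nonneg hv hq.le
  constructor
  · have : R ≤ (s * q / 2 + q * q + R * R) / R := by
      rw [le_div_iff₀ hR0]; nlinarith
    linarith
  · have : (s * q / 2 + q * q + R * R) / R ≤ 2 * R := by
      rw [div_le_iff₀ hR0]; nlinarith
    linarith

lemma logb_two_nonneg {t : ℝ} (ht : 1 ≤ t) : 0 ≤ Real.logb 2 t :=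
  Real.logb_nonneg (by norm_num) ht

lemma log_le_confExp {K : ℕ} {δ t : ℝ} (ht : 1 ≤ t) :
    Real.log (16 * (K : ℝ) / δ) ≤ confExp K δ t := by
  have := Real.log_nonneg (by linarith [logb_two_nonneg ht] : 1 ≤ Real.logb 2 t + 1)
  rw [confExp]; linarith

lemma two_le_confExp {K : ℕ} (hK : 1 ≤ K) {δ : ℝ} (hδ : 0 < δ) (hδ1 : δ ≤ 1) {t : ℝ}
    (ht : 1 ≤ t) : 2 ≤ confExp K δ t :=
  (two_le_log_sixteen_mul hK hδ hδ1).trans (log_le_confExp ht)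

lemma confExp_mono {K : ℕ} {δ s t : ℝ} (hs : 1 ≤ s) (hst : s ≤ t) :
    confExp K δ s ≤ confExp K δ t := by
  have h1 : Real.logb 2 s ≤ Real.logb 2 t := Real.logb_le_logb_of_le (by norm_num) (by linarith) hst
  have := Real.log_le_log (by linarith [logb_two_nonneg hs])
    (by linarith : Real.logb 2 s + 1 ≤ Real.logb 2 t + 1)
  rw [confExp, confExp]; linarith

lemma confExp_div_pos {K : ℕ} (hK : 1 ≤ K) {δ : ℝ} (hδ : 0 < δ) (hδ1 : δ ≤ 1) {t : ℝ}
    (ht : 1 ≤ t) : 0 < confExp K δ t / t :=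
  div_pos (by linarith [two_le_confExp hK hδ hδ1 ht]) (by linarith)

lemma radiusFn_nonneg {K : ℕ} {δ v t : ℝ} : 0 ≤ radiusFn K δ v t := by
  rw [radiusFn]; positivity

lemma div_le_radiusFn {K : ℕ} (hK : 1 ≤ K) {δ : ℝ} (hδ : 0 < δ) (hδ1 : δ ≤ 1) {v t : ℝ}
    (hv : 0 ≤ v) (ht : 1 ≤ t) : 4 / t ≤ radiusFn K δ v t := by
  have h := confExp_div_pos hK hδ hδ1 ht
  rw [radiusFn_eq h.le]
  refine le_trans ?_ (two_mul_le_radiusOf hv h.le)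
  rw [← mul_div_assoc]
  exact div_le_div_of_nonneg_right (by linarith [two_le_confExp hK hδ hδ1 ht]) (by linarith)

lemma radiusFn_half_le {K : ℕ} (hK : 1 ≤ K) {δ : ℝ} (hδ : 0 < δ) (hδ1 : δ ≤ 1) {v w t : ℝ}
    (hv : 0 ≤ v) (hw : v / 2 ≤ w) (ht : 1 ≤ t) :
    radiusFn K δ v t / 2 ≤ radiusFn K δ w (t + 1) := by
  have h := confExp_div_pos hK hδ hδ1 ht
  rw [radiusFn_eq h.le, radiusFn_eq (confExp_div_pos hK hδ hδ1 (by linarith)).le]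
  refine radiusOf_half_le hv h.le hw ?_
  rw [div_div, div_le_div_iff₀ (by linarith) (by linarith)]
  have := confExp_mono (K := K) (δ := δ) ht (by linarith : t ≤ t + 1)
  have := two_le_confExp hK hδ hδ1 ht
  nlinarith

/-- The radius has elasticity of order one in the number of evaluated points. -/
lemma abs_deriv_radiusFn {K : ℕ} (hK : 2 ≤ K) {δ : ℝ} (hδ : 0 < δ) (hδ1 : δ ≤ 1) {v t : ℝ}
    (hv : 0 ≤ v) (ht : 1 ≤ t) :
    |deriv (radiusFn K δ v) t| ≤ radiusFn K δ v t / t ∧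
      2 / 25 * (radiusFn K δ v t / t) ≤ |deriv (radiusFn K δ v) t| := by
  have hK1 : 1 ≤ K := by omega
  have ht0 : 0 < t := by linarith
  have hln2 := Real.log_two_gt_d9
  have hln0 : 0 < Real.log 2 := by linarith
  have hlb := logb_two_nonneg ht
  have hq := confExp_div_pos hK1 hδ hδ1 ht
  obtain ⟨F, hF, hF1, hF2⟩ := hasDerivAt_radiusOf hv hq
  have hL : HasDerivAt (confExp K δ) (2 * (1 / (t * Real.log 2) / (Real.logb 2 t + 1))) t := by
    have h1 : HasDerivAt (Real.logb 2) (1 / (t * Real.log 2)) t := by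
      have := (Real.hasDerivAt_log ht0.ne').div_const (Real.log 2)
      have e : 1 / (t * Real.log 2) = t⁻¹ / Real.log 2 := by field_simp
      rw [e]; exact this
    exact (((h1.add_const 1).log (by linarith)).const_mul 2).add_const _
  -- Here K ≥ 2 matters: L ≥ 5 ln 2 > 2/ln 2 ≥ c makes q = L/t decreasing. For K = 1, δ = 1, t = 1
  -- the difference L - c would be negative.
  have hL32 : 5 * Real.log 2 ≤ confExp K δ t := by
    refine le_trans ?_ (log_le_confExp ht)
    rw [show 5 * Real.log 2 = Real.log (2 ^ 5) by rw [Real.log_pow]; norm_num]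
    refine Real.log_le_log (by norm_num) ?_
    have : (2 : ℝ) ≤ K := by exact_mod_cast hK
    rw [le_div_iff₀ hδ]; nlinarith
  set c := 2 / (Real.log 2 * (Real.logb 2 t + 1)) with hc
  have hc0 : 0 < c := by positivity
  have hc1 : c ≤ 21 / 25 * confExp K δ t := by
    have : c ≤ 2 / Real.log 2 :=
      div_le_div_of_nonneg_left (by norm_num) hln0 (by nlinarith)
    have h3 : 2 / Real.log 2 ≤ 2886 / 1000 := by
      rw [div_le_iff₀ hln0]; linarith
    linarith
  have hqd := hL.div (hasDerivAt_id t) ht0.ne'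
  have hd := HasDerivAt.comp t
    (show HasDerivAt (radiusOf v) F ((confExp K δ / (id : ℝ → ℝ)) t) from hF) hqd
  have heq : radiusFn K δ v =ᶠ[nhds t] radiusOf v ∘ (confExp K δ / id) := by
    have h1 : ∀ᶠ s in nhds t, 0 < confExp K δ s / s :=
      hqd.continuousAt.eventually (lt_mem_nhds hq)
    filter_upwards [h1] with s hs
    exact radiusFn_eq hs.le
  have hdr := (hd.congr_of_eventuallyEq heq).deriv
  rw [hdr, radiusFn_eq hq.le]
  set L := confExp K δ t
  have hL0 : 0 < L := by linarith
  have e : F * ((2 * (1 / (t * Real.log 2) / (Real.logb 2 t + 1)) * id t - L * 1) / id t ^ 2) =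
      -((L / t * F) * ((L - c) / L) / t) := by
    simp only [id, hc]
    field_simp
    ring
  rw [e, abs_neg]
  have hR := radiusOf_nonneg (v := v) hq.le
  have hb1 : (L - c) / L ≤ 1 := by rw [div_le_one hL0]; linarith
  -- The elasticity of q in t is -(L - c)/L; with the factor 1/2 from the elasticity in q this gives
  -- the constant 2/25.
  have hb2 : 4 / 25 ≤ (L - c) / L := by rw [le_div_iff₀ hL0]; linarith
  have hqF : 0 ≤ L / t * F := by linarith
  rw [abs_of_nonneg (div_nonneg (mul_nonneg hqF (by linarith)) ht0.le)]
  constructor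
  · refine div_le_div_of_nonneg_right ?_ ht0.le
    nlinarith
  · rw [← mul_div_assoc]
    refine div_le_div_of_nonneg_right ?_ ht0.le
    nlinarith

/-- Near-monotonicity: log₂(xs) + 1 ≤ (log₂ x + 1)(log₂ s + 1), so a factor s in t adds at most 3s
to the exponent. -/
lemma confExp_div_le {K : ℕ} (hK : 1 ≤ K) {δ : ℝ} (hδ : 0 < δ) (hδ1 : δ ≤ 1) {x t : ℝ}
    (hx : 1 ≤ x) (hxt : x ≤ t) : confExp K δ t / t ≤ 3 * confExp K δ x / x := by
  have hx0 : 0 < x := by linarith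
  have ht0 : 0 < t := by linarith
  obtain ⟨s, rfl⟩ : ∃ s, t = x * s := ⟨t / x, by field_simp⟩
  have hs : 1 ≤ s := by nlinarith
  have hs0 : 0 < s := by linarith
  have h2 := two_le_confExp hK hδ hδ1 hx
  have hlx := logb_two_nonneg hx
  have hls := logb_two_nonneg hs
  have h3 : confExp K δ (x * s) ≤ confExp K δ x + 3 * s := by
    have h4 : Real.log (Real.logb 2 (x * s) + 1) ≤
        Real.log (Real.logb 2 x + 1) + Real.log (Real.logb 2 s + 1) := by
      rw [← Real.log_mul (by linarith) (by linarith), Real.logb_mul hx0.ne' hs0.ne']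
      exact Real.log_le_log (by linarith) (by nlinarith)
    have h5 : Real.log (Real.logb 2 s + 1) ≤ Real.logb 2 s := by
      have := Real.log_le_sub_one_of_pos (by linarith : 0 < Real.logb 2 s + 1)
      linarith
    have h6 : Real.logb 2 s ≤ 3 / 2 * s := by
      rw [Real.logb, div_le_iff₀ (Real.log_pos (by norm_num))]
      have := Real.log_le_sub_one_of_pos hs0
      nlinarith [Real.log_two_gt_d9]
    rw [confExp, confExp]; linarith
  rw [div_le_div_iff₀ ht0 hx0]
  nlinarith

lemma radiusOf_mono {v w q p : ℝ} (hv : 0 ≤ v) (hq : 0 ≤ q) (hw : v ≤ w) (hp : q ≤ p) :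
    radiusOf v q ≤ radiusOf w p := by
  have hs := Real.sqrt_le_sqrt hp
  have hs0 := Real.sqrt_nonneg q
  have hp0 := hq.trans hp
  have hw0 := hv.trans hw
  rw [radiusOf, radiusOf]
  gcongr

/-- By ε² ≤ κ³ the root of q = ε²/(300κ) is at most κ/17, so the variance term dominates and the
radius is of order √(κq). -/
lemma radiusOf_le_quarter {ε κ : ℝ} (hε : 0 < ε) (hε1 : ε ≤ 1) (hκ0 : 0 < κ)
    (hκ : ε ^ 2 ≤ κ ^ 3) : radiusOf κ (ε ^ 2 / (300 * κ)) ≤ ε / 4 := by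
  have hεκ : ε ≤ κ := by
    have : ε ^ 3 ≤ κ ^ 3 := le_trans (by nlinarith [sq_nonneg ε]) hκ
    exact le_of_pow_le_pow_left₀ (by norm_num) hκ0.le this
  have h1 : ε ^ 2 / (300 * κ) ≤ (κ / 17) ^ 2 := by
    rw [div_le_iff₀ (by positivity)]
    nlinarith [pow_pos hκ0 3]
  have h2 : Real.sqrt (ε ^ 2 / (300 * κ)) ≤ κ / 17 := by
    rw [Real.sqrt_le_left (by positivity)]; exact h1
  have h3 : ε ^ 2 / (300 * κ) ≤ ε / 300 := by
    rw [div_le_div_iff₀ (by positivity) (by norm_num)]; nlinarith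
  have hq0 : 0 ≤ ε ^ 2 / (300 * κ) := by positivity
  have h4 : (κ + Real.sqrt (ε ^ 2 / (300 * κ)) + ε ^ 2 / (300 * κ)) * (ε ^ 2 / (300 * κ)) ≤
      (ε / 15) ^ 2 := by
    calc _ ≤ (κ + κ / 17 + κ / 17) * (ε ^ 2 / (300 * κ)) := by
          refine mul_le_mul_of_nonneg_right ?_ hq0
          nlinarith
      _ = ε ^ 2 * (19 / 17 / 300) := by field_simp; norm_num
      _ ≤ _ := by nlinarith [sq_nonneg ε]
  have h5 := (Real.sqrt_le_left (by positivity : 0 ≤ ε / 15)).mpr h4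
  rw [radiusOf]; linarith

/-! ### The number of points that suffices in one cell. -/

/-- The number of points per cell, up to constants, that brings the confidence radius of every cell
of variance at most `κ` to the order of `ε`. -/
def cellComplexity (K : ℕ) (κ ε δ : ℝ) : ℝ :=
  13500 * ((Real.log (1 / δ) + Real.log (Real.log (1 / ε))) * Real.log ((K : ℝ) + 1)) * κ / ε ^ 2

/-- The error level is small. -/
structure IsSmall (ε : ℝ) : Prop where
  pos : 0 < ε
  le : ε ≤ Real.exp (-Real.exp 12)

lemma IsSmall.exp_le_log {ε : ℝ} (h : IsSmall ε) : Real.exp 12 ≤ Real.log (1 / ε) := by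
  rw [one_div, Real.log_inv, le_neg, Real.log_le_iff_le_exp h.pos]
  exact h.le

lemma IsSmall.le_loglog {ε : ℝ} (h : IsSmall ε) : 12 ≤ Real.log (Real.log (1 / ε)) := by
  rw [Real.le_log_iff_exp_le (lt_of_lt_of_le (Real.exp_pos _) h.exp_le_log)]
  exact h.exp_le_log

lemma exp_twelve_ge : (4096 : ℝ) ≤ Real.exp 12 := by
  have h : (2 : ℝ) ≤ Real.exp 1 := by linarith [Real.add_one_le_exp (1 : ℝ)]
  calc (4096 : ℝ) = 2 ^ 12 := by norm_num
    _ ≤ Real.exp 1 ^ 12 := pow_le_pow_left₀ (by norm_num) h 12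
    _ = Real.exp 12 := by rw [← Real.exp_nat_mul]; norm_num

lemma IsSmall.le_log {ε : ℝ} (h : IsSmall ε) : 4096 ≤ Real.log (1 / ε) :=
  exp_twelve_ge.trans h.exp_le_log

lemma IsSmall.le_inv {ε : ℝ} (h : IsSmall ε) : ε ≤ 1 / 4096 := by
  have h1 : Real.exp 4096 ≤ 1 / ε := by
    rw [← Real.le_log_iff_exp_le (by have := h.pos; positivity)]; exact h.le_log
  have h2 := Real.add_one_le_exp (4096 : ℝ)
  rw [le_div_iff₀ (by norm_num)]
  have h3 : (4096 : ℝ) ≤ 1 / ε := by linarith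
  rw [le_div_iff₀ h.pos] at h3
  linarith

lemma le_log_add_one {K : ℕ} (hK : 1 ≤ K) : 69 / 100 ≤ Real.log ((K : ℝ) + 1) := by
  have : Real.log 2 ≤ Real.log ((K : ℝ) + 1) := by
    refine Real.log_le_log (by norm_num) ?_
    have : (1 : ℝ) ≤ K := by exact_mod_cast hK
    linarith
  linarith [Real.log_two_gt_d9]

section Complexity

variable {K : ℕ} {ε δ κ : ℝ}

lemma one_le_cellComplexity (hK : 1 ≤ K) (hε : IsSmall ε) (hδ : 0 < δ) (hδ1 : δ ≤ 1)
    (hκ0 : 0 < κ) (hκ : ε ^ 2 ≤ κ ^ 3) (hκ1 : κ ≤ 1) : 1 ≤ cellComplexity K κ ε δ := by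
  have h0 := hε.pos
  have h1 := hε.le_inv
  have h2 := hε.le_loglog
  have h3 := le_log_add_one hK
  have h4 : 0 ≤ Real.log (1 / δ) := Real.log_nonneg (by rw [le_div_iff₀ hδ]; linarith)
  have h5 : 8 ≤ (Real.log (1 / δ) + Real.log (Real.log (1 / ε))) * Real.log ((K : ℝ) + 1) := by
    nlinarith
  have h6 : ε ^ 2 ≤ κ := hκ.trans (by nlinarith [mul_nonneg hκ0.le hκ0.le])
  rw [cellComplexity, le_div_iff₀ (by positivity)]
  nlinarith

/-- The complexity is at most Q times a power of 1/ε, so its iterated logarithm is O(Q), and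
ln(16K/δ) ≤ 3 + Λ + Q. As Q ≥ 12 and Λ ≥ 0.69, everything is absorbed by QΛ. -/
lemma confExp_cellComplexity_le (hK : 1 ≤ K) (hKε : (K : ℝ) ≤ 1 / ε) (hε : IsSmall ε)
    (hδ : 0 < δ) (hδ1 : δ ≤ 1) (hκ0 : 0 < κ) (hκ : ε ^ 2 ≤ κ ^ 3) (hκ1 : κ ≤ 1) :
    confExp K δ (cellComplexity K κ ε δ) ≤
      15 * ((Real.log (1 / δ) + Real.log (Real.log (1 / ε))) * Real.log ((K : ℝ) + 1)) := by
  have hx1 := one_le_cellComplexity hK hε hδ hδ1 hκ0 hκ hκ1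
  have h0 := hε.pos
  have h2 := hε.le_loglog
  have h3 := le_log_add_one hK
  have hl := hε.le_log
  have hK' : (1 : ℝ) ≤ K := by exact_mod_cast hK
  have h4 : 0 ≤ Real.log (1 / δ) := Real.log_nonneg (by rw [le_div_iff₀ hδ]; linarith)
  have hKlog : Real.log ((K : ℝ) + 1) ≤ 1 / ε := by
    have := Real.log_le_sub_one_of_pos (by linarith : (0 : ℝ) < K + 1)
    linarith
  set Q := Real.log (1 / δ) + Real.log (Real.log (1 / ε)) with hQ
  have hQ12 : 12 ≤ Q := by linarith
  set l := Real.log (1 / ε) with hldef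
  set x := cellComplexity K κ ε δ with hx
  have hxle : x ≤ 13500 * Q * (1 / ε) ^ 3 := by
    have : x = 13500 * Q * (Real.log ((K : ℝ) + 1) * κ) * (1 / ε) ^ 2 := by
      rw [hx, cellComplexity, ← hldef, ← hQ]; field_simp
    rw [this]
    have h5 : Real.log ((K : ℝ) + 1) * κ ≤ 1 / ε := by
      nlinarith
    calc _ ≤ 13500 * Q * (1 / ε) * (1 / ε) ^ 2 := by gcongr
      _ = _ := by ring
  have hlogx : Real.log x ≤ 10 + Q + 3 * l := by
    have h6 := Real.log_le_log (by linarith) hxle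
    rw [Real.log_mul (by positivity) (by positivity), Real.log_mul (by norm_num) (by linarith),
      Real.log_pow] at h6
    have h7 := Real.log_le_sub_one_of_pos (by linarith : 0 < Q)
    have h8 : Real.log 13500 ≤ 10 := by
      rw [Real.log_le_iff_le_exp (by norm_num)]
      have h : (27 / 10 : ℝ) ≤ Real.exp 1 := by linarith [Real.exp_one_gt_d9]
      calc (13500 : ℝ) ≤ (27 / 10) ^ 10 := by norm_num
        _ ≤ Real.exp 1 ^ 10 := pow_le_pow_left₀ (by norm_num) h 10
        _ = Real.exp 10 := by rw [← Real.exp_nat_mul]; norm_num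
    push_cast at h6
    linarith
  have hlb : Real.logb 2 x + 1 ≤ 8 * l * (1 + Q) := by
    have h9 : Real.logb 2 x ≤ 3 / 2 * (10 + Q + 3 * l) := by
      rw [Real.logb, div_le_iff₀ (Real.log_pos (by norm_num))]
      nlinarith [Real.log_two_gt_d9]
    nlinarith
  have hll : Real.log (Real.logb 2 x + 1) ≤ 3 + 2 * Q := by
    have h10 := Real.log_le_log (by linarith [logb_two_nonneg hx1]) hlb
    rw [Real.log_mul (by positivity) (by linarith), Real.log_mul (by norm_num) (by linarith)] at h10
    have h11 := Real.log_le_sub_one_of_pos (by linarith : 0 < 1 + Q)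
    have h12 : Real.log 8 = 3 * Real.log 2 := by
      rw [show (8 : ℝ) = 2 ^ 3 by norm_num, Real.log_pow]; norm_num
    linarith [Real.log_two_lt_d9]
  have hrest : Real.log (16 * (K : ℝ) / δ) ≤ 3 + Real.log ((K : ℝ) + 1) + Q := by
    rw [Real.log_div (by positivity) hδ.ne', Real.log_mul (by norm_num) (by positivity)]
    have h13 : Real.log 16 = 4 * Real.log 2 := by
      rw [show (16 : ℝ) = 2 ^ 4 by norm_num, Real.log_pow]; norm_num
    have h14 := Real.log_le_log (by linarith) (by linarith : (K : ℝ) ≤ K + 1)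
    have h15 : Real.log (1 / δ) = -Real.log δ := by rw [one_div, Real.log_inv]
    linarith [Real.log_two_lt_d9]
  rw [confExp]
  nlinarith

lemma radiusFn_le_quarter (hK : 1 ≤ K) (hKε : (K : ℝ) ≤ 1 / ε) (hε : IsSmall ε)
    (hδ : 0 < δ) (hδ1 : δ ≤ 1) (hκ0 : 0 < κ) (hκ : ε ^ 2 ≤ κ ^ 3) (hκ1 : κ ≤ 1) {v t : ℝ}
    (hv0 : 0 ≤ v) (hv : v ≤ κ) (ht : cellComplexity K κ ε δ ≤ t) :
    radiusFn K δ v t ≤ ε / 4 := by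
  have h0 := hε.pos
  have hx1 := one_le_cellComplexity hK hε hδ hδ1 hκ0 hκ hκ1
  have hx := confExp_cellComplexity_le hK hKε hε hδ hδ1 hκ0 hκ hκ1
  have hq := confExp_div_pos hK hδ hδ1 (hx1.trans ht)
  rw [radiusFn_eq hq.le]
  refine (radiusOf_mono hv0 hq.le hv ((confExp_div_le hK hδ hδ1 hx1 ht).trans ?_)).trans
    (radiusOf_le_quarter h0 (hε.le_inv.trans (by norm_num)) hκ0 hκ)
  -- The constant is 13500 = 3 · 15 · 300: near-monotonicity, the exponent bound, and the choice of
  -- q.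
  rw [div_le_div_iff₀ (by linarith) (by positivity)]
  have e : ε ^ 2 * cellComplexity K κ ε δ = 13500 *
      ((Real.log (1 / δ) + Real.log (Real.log (1 / ε))) * Real.log ((K : ℝ) + 1)) * κ := by
    rw [cellComplexity]; field_simp
  rw [e]
  nlinarith

end Complexity

/-! ### The adaptive evaluation on a fixed dataset -/

/-- The cells `A` form a partition. -/
structure IsCellPartition {E : Type*} {K : ℕ} (A : Fin K → Set E) : Prop where
  cover : ∀ x, ∃ k, x ∈ A k
  disjoint : ∀ x j k, x ∈ A j → x ∈ A k → j = k

section Deterministic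

variable {E : Type*} {n K : ℕ} {Z : E → ℝ} {A : Fin K → Set E} {δ ε : ℝ} {D : Fin n → E}
  {S : Finset (Fin n)} {k : Fin K}

lemma mem_group {i : Fin n} : i ∈ group A D k ↔ D i ∈ A k := by simp [group]

lemma mem_seen {i : Fin n} : i ∈ seen A D S k ↔ i ∈ S ∧ D i ∈ A k := by simp [seen, mem_group]

lemma sum_card_seen (hA : IsCellPartition A) (S : Finset (Fin n)) :
    ∑ k, (seen A D S k).card = S.card := by
  classical
  rw [← Finset.card_biUnion]
  · congr 1
    ext i
    simp only [Finset.mem_biUnion, Finset.mem_univ, true_and, mem_seen]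
    exact ⟨fun ⟨_, h, _⟩ => h, fun h => let ⟨k, hk⟩ := hA.cover (D i); ⟨k, h, hk⟩⟩
  · intro j _ k _ hjk
    refine Finset.disjoint_left.mpr fun i hi hi' => hjk ?_
    exact hA.disjoint _ _ _ (mem_seen.mp hi).2 (mem_seen.mp hi').2

lemma sum_card_group (hA : IsCellPartition A) (D : Fin n → E) :
    ∑ k, (group A D k).card = n := by
  have h := sum_card_seen (D := D) hA Finset.univ
  simpa [seen] using h

lemma share_nonneg : 0 ≤ share A D k := div_nonneg (Nat.cast_nonneg _) (Nat.cast_nonneg _)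

lemma sum_share (hA : IsCellPartition A) (hn : n ≠ 0) (D : Fin n → E) :
    ∑ k, share A D k = 1 := by
  simp only [share, ← Finset.sum_div]
  rw [← Nat.cast_sum, sum_card_group hA, div_self (by exact_mod_cast hn)]

lemma groupVar_nonneg : 0 ≤ groupVar Z A D S k := empVar_nonneg Z D _

lemma exists_isTarget (hA : IsCellPartition A) (hS : S ≠ Finset.univ) :
    ∃ k, IsTarget Z A δ D S k := by
  classical
  obtain ⟨i, hi⟩ : ∃ i, i ∉ S := by
    by_contra h; push Not at h; exact hS (Finset.eq_univ_iff_forall.mpr h)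
  obtain ⟨k₀, hk₀⟩ := hA.cover (D i)
  obtain ⟨k, hk, hmax⟩ := Finset.exists_max_image
    (Finset.univ.filter fun k => IsAvailable A D S k) (priority Z A δ D S)
    ⟨k₀, by simpa using ⟨i, hi, hk₀⟩⟩
  refine ⟨k, by simpa using hk, fun j hj => hmax j (by simpa using hj)⟩

lemma step_of_isDone (h : IsDone Z A δ D S ε) : step Z A δ D S ε = S := by
  simp [step, h]

/-- A round before termination evaluates the first unevaluated point of a target cell. -/
lemma step_of_not_isDone (hA : IsCellPartition A) (h : ¬ IsDone Z A δ D S ε) :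
    ∃ i k, i ∉ S ∧ D i ∈ A k ∧ IsTarget Z A δ D S k ∧ (∀ j, j < i → D j ∈ A k → j ∈ S) ∧
      step Z A δ D S ε = insert i S := by
  have hS : S ≠ Finset.univ := fun e => h (Or.inr e)
  obtain ⟨k₀, hk₀⟩ := exists_isTarget (Z := Z) (δ := δ) (D := D) hA hS
  have hne : (candidates Z A δ D S).Nonempty := by
    obtain ⟨i, hi, hik⟩ := hk₀.1
    exact ⟨i, by simpa [candidates] using ⟨hi, k₀, hk₀, hik⟩⟩
  have hm := Finset.min'_mem _ hne
  have hle := fun j hj => Finset.min'_le (candidates Z A δ D S) j hj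
  have hst : step Z A δ D S ε = insert ((candidates Z A δ D S).min' hne) S := by
    simp [step, h, hne]
  set i := (candidates Z A δ D S).min' hne
  obtain ⟨hiS, k, hk, hik⟩ : i ∉ S ∧ ∃ k, IsTarget Z A δ D S k ∧ D i ∈ A k := by
    simpa [candidates] using hm
  refine ⟨i, k, hiS, hik, hk, fun j hj hjk => ?_, hst⟩
  by_contra hjS
  exact absurd (hle j (by simpa [candidates] using ⟨hjS, k, hk, hjk⟩)) (not_le.mpr hj)

lemma seen_insert_self {i : Fin n} (hi : i ∉ S) (hik : D i ∈ A k) :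
    seen A D (insert i S) k = insert i (seen A D S k) ∧ i ∉ seen A D S k := by
  refine ⟨?_, fun h => hi (mem_seen.mp h).1⟩
  ext j
  simp only [mem_seen, Finset.mem_insert]
  constructor
  · rintro ⟨rfl | h, h2⟩ <;> simp_all
  · rintro (rfl | h)
    · exact ⟨Or.inl rfl, hik⟩
    · exact ⟨Or.inr h.1, h.2⟩

lemma seen_insert_of_ne (hA : IsCellPartition A) {i : Fin n} {j : Fin K} (hik : D i ∈ A k)
    (hj : j ≠ k) : seen A D (insert i S) j = seen A D S j := by
  ext q
  simp only [mem_seen, Finset.mem_insert]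
  constructor
  · rintro ⟨rfl | h, h2⟩
    · exact absurd (hA.disjoint _ _ _ h2 hik) hj
    · exact ⟨h, h2⟩
  · rintro ⟨h, h2⟩; exact ⟨Or.inr h, h2⟩

lemma evaluatedSet_isDone_or (hA : IsCellPartition A) (m t : ℕ) :
    IsDone Z A δ D (evaluatedSet Z A δ D ε m t) ε ∨ t ≤ (evaluatedSet Z A δ D ε m t).card := by
  induction t with
  | zero => exact Or.inr (Nat.zero_le _)
  | succ t ih =>
    by_cases h : IsDone Z A δ D (evaluatedSet Z A δ D ε m t) ε
    · left; rw [evaluatedSet, step_of_isDone h]; exact h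
    · right
      obtain ⟨i, k, hi, -, -, -, hst⟩ := step_of_not_isDone hA h
      rw [evaluatedSet, hst, Finset.card_insert_of_notMem hi]
      have := ih.resolve_left h
      omega

lemma evaluatedSet_isDone (hA : IsCellPartition A) (m : ℕ) :
    IsDone Z A δ D (evaluatedSet Z A δ D ε m n) ε := by
  rcases evaluatedSet_isDone_or (Z := Z) (δ := δ) (ε := ε) (D := D) hA m n with h | h
  · exact h
  · right
    refine Finset.eq_univ_of_card _ (le_antisymm (Finset.card_le_univ _) ?_)
    simpa using h

/-- The evaluated points of every cell are the first ones of the dataset. -/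
lemma evaluatedSet_lower (hA : IsCellPartition A) (m t : ℕ) :
    ∀ i ∈ evaluatedSet Z A δ D ε m t, ∀ j < i, ∀ k, D i ∈ A k → D j ∈ A k →
      j ∈ evaluatedSet Z A δ D ε m t := by
  induction t with
  | zero =>
    intro i hi j hj k _ _
    simp only [evaluatedSet, Finset.mem_filter, Finset.mem_univ, true_and] at hi ⊢
    exact lt_trans (by exact_mod_cast hj) hi
  | succ t ih =>
    by_cases h : IsDone Z A δ D (evaluatedSet Z A δ D ε m t) ε
    · rw [evaluatedSet, step_of_isDone h]; exact ih
    · obtain ⟨i₀, k₀, hi₀, hik₀, -, hlow, hst⟩ := step_of_not_isDone hA h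
      rw [evaluatedSet, hst]
      intro i hi j hj k hik hjk
      rcases Finset.mem_insert.mp hi with rfl | hi
      · obtain rfl := hA.disjoint _ _ _ hik hik₀
        exact Finset.mem_insert_of_mem (hlow j hj hjk)
      · exact Finset.mem_insert_of_mem (ih i hi j hj k hik hjk)

/-- Whatever the adaptive rule does, the sample of a cell is one of the prefixes covered by the
uniform confidence bound. -/
lemma seen_eq_cellPrefix (hA : IsCellPartition A) (m t : ℕ) (k : Fin K) :
    ∃ i, seen A D (evaluatedSet Z A δ D ε m t) k = cellPrefix (A k) D i := by
  have hlow := evaluatedSet_lower (Z := Z) (δ := δ) (ε := ε) (D := D) hA m t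
  set S := evaluatedSet Z A δ D ε m t
  -- One past the last evaluated point of the cell, or 0 if there is none.
  refine ⟨(seen A D S k).sup fun i => (i : ℕ) + 1, ?_⟩
  ext j
  rw [mem_seen, cellPrefix]
  simp only [Finset.mem_filter, Finset.mem_univ, true_and]
  constructor
  · rintro ⟨hj, hjk⟩
    exact ⟨Nat.lt_of_succ_le (Finset.le_sup (f := fun i : Fin n => (i : ℕ) + 1)
      (mem_seen.mpr ⟨hj, hjk⟩)), hjk⟩
  · rintro ⟨hj, hjk⟩
    refine ⟨?_, hjk⟩
    obtain ⟨i, hi, hji⟩ := Finset.lt_sup_iff.mp hj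
    obtain ⟨hiS, hik⟩ := mem_seen.mp hi
    rcases Nat.lt_succ_iff_lt_or_eq.mp hji with h | h
    · exact hlow i hiS j (by exact_mod_cast h) k hik hjk
    · rwa [Fin.ext h]

lemma ciRadius_eq_ofReal (h : ∀ j, (seen A D S j).card ≠ 0) :
    ciRadius Z A δ D S = ENNReal.ofReal
      (∑ j, share A D j * radiusFn K δ (groupVar Z A D S j) (seen A D S j).card) := by
  rw [ENNReal.ofReal_sum_of_nonneg fun j _ => mul_nonneg share_nonneg radiusFn_nonneg, ciRadius]
  refine Finset.sum_congr rfl fun j _ => ?_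
  rw [groupRadius, if_neg (h j), ENNReal.ofReal_mul share_nonneg]

lemma le_card_of_not_isAvailable (h : ¬ IsAvailable A D S k) :
    (group A D k).card ≤ (seen A D S k).card := by
  refine Finset.card_le_card fun i hi => ?_
  rw [mem_group] at hi
  rw [mem_seen]
  refine ⟨?_, hi⟩
  by_contra hS
  exact h ⟨i, hS, hi⟩

/-- A cell is over-sampled by the greedy rule only in proportion to its share. -/
lemma card_seen_le_of_isTarget (hδ : 0 < δ) (hδ1 : δ ≤ 1) (hε : 0 < ε)
    (hA : IsCellPartition A) (hn : n ≠ 0) {N : ℕ} (hN : 1 ≤ N)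
    (hgroup : ∀ j, N ≤ (group A D j).card)
    (hrad : ∀ j, N ≤ (seen A D S j).card →
      radiusFn K δ (groupVar Z A D S j) (seen A D S j).card ≤ ε / 4)
    (hdone : ¬ IsDone Z A δ D S ε) (hk : IsTarget Z A δ D S k)
    (hNk : N ≤ (seen A D S k).card) :
    ((seen A D S k).card : ℝ) ≤ 5 * K * N * share A D k := by
  have hk0 : (seen A D S k).card ≠ 0 := by omega
  have hpk : priority Z A δ D S k = ENNReal.ofReal
      (share A D k * |deriv (radiusFn K δ (groupVar Z A D S k)) (seen A D S k).card|) := by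
    rw [priority, if_neg hk0]
  -- An available cell without evaluations would have priority ⊤ and beat k; an unavailable one has
  -- all of its at least N points evaluated.
  have hpos : ∀ j, (seen A D S j).card ≠ 0 := by
    intro j hj
    by_cases hav : IsAvailable A D S j
    · have := hk.2 j hav
      rw [hpk, priority, if_pos hj] at this
      exact ENNReal.ofReal_ne_top (top_le_iff.mp this)
    · have := le_card_of_not_isAvailable hav
      have := hgroup j
      omega
  set r : Fin K → ℝ := fun j => radiusFn K δ (groupVar Z A D S j) (seen A D S j).card with hr
  have hsum : ε < ∑ j, share A D j * r j := by
    have h1 := not_le.mp fun h => hdone (Or.inl h)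
    rw [ciRadius_eq_ofReal hpos] at h1
    exact (ENNReal.ofReal_lt_ofReal_iff_of_nonneg hε.le).mp h1
  set c : ℝ := ((seen A D S k).card : ℝ) with hc
  have hc1 : 1 ≤ c := by rw [hc]; exact_mod_cast Nat.one_le_iff_ne_zero.mpr hk0
  have hN0 : (1 : ℝ) ≤ N := by exact_mod_cast hN
  -- Cells with N points contribute at most a quarter of ε in total. For the others, maximality of k
  -- and the elasticity bounds give share·r/a ≤ (25/2)(share of k)(ε/4)/c with a ≤ N, which leaves K
  -- terms to carry 3ε/4.
  have hbound : ∀ j, share A D j * r j ≤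
      share A D j * (ε / 4) + 25 / 8 * N * share A D k * ε / c := by
    intro j
    have hnn : 0 ≤ 25 / 8 * N * share A D k * ε / c := by
      have := share_nonneg (A := A) (D := D) (k := k)
      positivity
    by_cases hj : N ≤ (seen A D S j).card
    · have := mul_le_mul_of_nonneg_left (hrad j hj) (share_nonneg (A := A) (D := D) (k := j))
      linarith
    have hK2 : 2 ≤ K := by
      have hne : j ≠ k := by rintro rfl; exact hj hNk
      have h1 := j.isLt
      have h2 := k.isLt
      by_contra hlt
      exact hne (Fin.ext (by omega))
    have hav : IsAvailable A D S j := by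
      by_contra hav
      have := le_card_of_not_isAvailable hav
      have := hgroup j
      omega
    have hp := hk.2 j hav
    rw [hpk, priority, if_neg (hpos j)] at hp
    rw [ENNReal.ofReal_le_ofReal_iff (mul_nonneg share_nonneg (abs_nonneg _))] at hp
    have hj1 : (1 : ℝ) ≤ (seen A D S j).card := by
      exact_mod_cast Nat.one_le_iff_ne_zero.mpr (hpos j)
    have hjN : ((seen A D S j).card : ℝ) ≤ N := by exact_mod_cast (not_le.mp hj).le
    have d1 := (abs_deriv_radiusFn hK2 hδ hδ1 (groupVar_nonneg (Z := Z) (A := A) (D := D) (S := S)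
      (k := j)) hj1).2
    have d2 := (abs_deriv_radiusFn hK2 hδ hδ1 (groupVar_nonneg (Z := Z) (A := A) (D := D) (S := S)
      (k := k)) hc1).1
    have d3 : share A D j * (2 / 25 * (r j / (seen A D S j).card)) ≤
        share A D k * ((ε / 4) / c) :=
      (mul_le_mul_of_nonneg_left d1 share_nonneg).trans (hp.trans
        (mul_le_mul_of_nonneg_left (d2.trans (div_le_div_of_nonneg_right (hrad k hNk)
          (by linarith))) share_nonneg))
    have hs := share_nonneg (A := A) (D := D) (k := j)
    have hsk := share_nonneg (A := A) (D := D) (k := k)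
    set a : ℝ := ((seen A D S j).card : ℝ)
    calc share A D j * r j = 25 / 2 * a * (share A D j * (2 / 25 * (r j / a))) := by
          field_simp
      _ ≤ 25 / 2 * a * (share A D k * ((ε / 4) / c)) :=
          mul_le_mul_of_nonneg_left d3 (by linarith)
      _ ≤ 25 / 2 * N * (share A D k * ((ε / 4) / c)) := by gcongr
      _ = 25 / 8 * N * share A D k * ε / c := by ring
      _ ≤ _ := by
          have := mul_nonneg hs hε.le
          linarith
  have htot := Finset.sum_le_sum fun j (_ : j ∈ Finset.univ) => hbound j
  rw [Finset.sum_add_distrib, ← Finset.sum_mul, sum_share hA hn] at htot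
  simp only [Finset.sum_const, Finset.card_univ, Fintype.card_fin, nsmul_eq_mul] at htot
  have h2 : 3 / 4 * ε ≤ K * (25 / 8 * N * share A D k * ε / c) := by linarith
  have h3 : K * (25 / 8 * N * share A D k * ε / c) =
      25 / 8 * (K * N * share A D k) / c * ε := by ring
  rw [h3] at h2
  have h4 := le_of_mul_le_mul_right h2 hε
  rw [le_div_iff₀ (by linarith)] at h4
  have : 0 ≤ K * N * share A D k := by
    have := share_nonneg (A := A) (D := D) (k := k)
    positivity
  linarith

lemma card_evaluatedSet_zero_le (m : ℕ) : (evaluatedSet Z A δ D ε m 0).card ≤ m := by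
  rw [evaluatedSet]
  calc _ = ((Finset.univ.filter fun i : Fin n => (i : ℕ) < m).map Fin.valEmbedding).card := by
        rw [Finset.card_map]
    _ ≤ (Finset.range m).card := by
        refine Finset.card_le_card fun i hi => ?_
        simp only [Finset.mem_map, Finset.mem_filter, Finset.mem_univ, true_and] at hi
        obtain ⟨a, ha, rfl⟩ := hi
        simpa using ha
    _ = m := Finset.card_range m

lemma evaluatedSet_succ (m t : ℕ) : evaluatedSet Z A δ D ε m (t + 1) =
    step Z A δ D (evaluatedSet Z A δ D ε m t) ε := rfl

/-- A cell grows only as a target, and after such a round it has at most max(N, 5KN·share) + 1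
points. The shares sum to one. -/
lemma card_evaluatedSet_le (hδ : 0 < δ) (hδ1 : δ ≤ 1) (hε : 0 < ε)
    (hA : IsCellPartition A) (hn : n ≠ 0) {N : ℕ} (hN : 1 ≤ N)
    (hgroup : ∀ j, N ≤ (group A D j).card)
    (hrad : ∀ S j, N ≤ (seen A D S j).card →
      radiusFn K δ (groupVar Z A D S j) (seen A D S j).card ≤ ε / 4) (m t : ℕ) :
    ((evaluatedSet Z A δ D ε m t).card : ℝ) ≤ m + 7 * (K * N) := by
  have key : ∀ k, ((seen A D (evaluatedSet Z A δ D ε m t) k).card : ℝ) ≤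
      (seen A D (evaluatedSet Z A δ D ε m 0) k).card + (N + 5 * K * N * share A D k + 1) := by
    intro k
    have hnn : 0 ≤ 5 * K * N * share A D k := by
      have := share_nonneg (A := A) (D := D) (k := k)
      positivity
    have hN0 : (1 : ℝ) ≤ N := by exact_mod_cast hN
    induction t with
    | zero => linarith
    | succ t ih =>
      by_cases h : IsDone Z A δ D (evaluatedSet Z A δ D ε m t) ε
      · rw [evaluatedSet_succ, step_of_isDone h]; exact ih
      · obtain ⟨i, k', hi, hik, hk', -, hst⟩ := step_of_not_isDone hA h
        rw [evaluatedSet_succ, hst]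
        by_cases hkk : k = k'
        · subst hkk
          obtain ⟨h1, h2⟩ := seen_insert_self (A := A) hi hik
          rw [h1, Finset.card_insert_of_notMem h2]
          have h0 : (0 : ℝ) ≤ (seen A D (evaluatedSet Z A δ D ε m 0) k).card := Nat.cast_nonneg _
          push_cast
          by_cases hNk : N ≤ (seen A D (evaluatedSet Z A δ D ε m t) k).card
          · have := card_seen_le_of_isTarget hδ hδ1 hε hA hn hN hgroup (hrad _) h hk' hNk
            linarith
          · have : ((seen A D (evaluatedSet Z A δ D ε m t) k).card : ℝ) ≤ N := by
              exact_mod_cast (not_le.mp hNk).le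
            linarith
        · rw [seen_insert_of_ne hA hik hkk]; exact ih
  rw [← sum_card_seen (D := D) hA, Nat.cast_sum]
  refine (Finset.sum_le_sum fun k _ => key k).trans ?_
  rw [Finset.sum_add_distrib, ← Nat.cast_sum, sum_card_seen hA, Finset.sum_add_distrib,
    Finset.sum_add_distrib, ← Finset.mul_sum, sum_share hA hn]
  simp only [Finset.sum_const, Finset.card_univ, Fintype.card_fin, nsmul_eq_mul]
  have h0 : ((evaluatedSet Z A δ D ε m 0).card : ℝ) ≤ m := by
    exact_mod_cast card_evaluatedSet_zero_le m
  have hN0 : (1 : ℝ) ≤ N := by exact_mod_cast hN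
  have : (K : ℝ) * 1 ≤ K * N := mul_le_mul_of_nonneg_left hN0 (Nat.cast_nonneg _)
  linarith

lemma ciRadius_le (hε : 0 < ε) (hA : IsCellPartition A) (hn : n ≠ 0) {N : ℕ} (hN : 1 ≤ N)
    (hgroup : ∀ j, N ≤ (group A D j).card)
    (hrad : ∀ S j, N ≤ (seen A D S j).card →
      radiusFn K δ (groupVar Z A D S j) (seen A D S j).card ≤ ε / 4) (m : ℕ) :
    ciRadius Z A δ D (evaluatedSet Z A δ D ε m n) ≤ ENNReal.ofReal ε := by
  rcases evaluatedSet_isDone (Z := Z) (δ := δ) (ε := ε) (D := D) hA m with h | h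
  · exact h
  -- If everything is evaluated, each cell has N points and radius at most ε/4.
  · rw [h]
    have hN' : ∀ j, N ≤ (seen A D Finset.univ j).card := fun j => by
      have : seen A D Finset.univ j = group A D j := by simp [seen]
      rw [this]; exact hgroup j
    rw [ciRadius_eq_ofReal fun j => by have := hN' j; omega]
    refine ENNReal.ofReal_le_ofReal ?_
    calc _ ≤ ∑ j, share A D j * (ε / 4) := Finset.sum_le_sum fun j _ =>
          mul_le_mul_of_nonneg_left (hrad _ j (hN' j)) share_nonneg
      _ = ε / 4 := by rw [← Finset.sum_mul, sum_share hA hn, one_mul]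
      _ ≤ ε := by linarith

/-- The sum of squared deviations cannot decrease when a point is added, and the count at most
doubles. -/
lemma groupVar_half_le {i : Fin n} (hi : i ∉ S) (hik : D i ∈ A k) (h0 : (seen A D S k).card ≠ 0) :
    groupVar Z A D S k / 2 ≤ groupVar Z A D (insert i S) k := by
  obtain ⟨h1, h2⟩ := seen_insert_self (A := A) hi hik
  have hc := Finset.card_insert_of_notMem h2
  show empVar Z D (seen A D S k) / 2 ≤ empVar Z D (seen A D (insert i S) k)
  rw [h1]
  set s := seen A D S k
  set r := empMean Z D (insert i s) with hr
  have hsc : (1 : ℝ) ≤ s.card := by exact_mod_cast Nat.one_le_iff_ne_zero.mpr h0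
  have e1 := sum_sq_sub_eq Z D h0 r
  have e2 := sum_sq_sub_eq Z D (s := insert i s) (by omega) r
  rw [Finset.sum_insert h2, e1, hc] at e2
  push_cast at e2
  rw [← hr, sub_self] at e2
  have hv := empVar_nonneg Z D s
  have h3 : s.card * empVar Z D s ≤ (s.card + 1) * empVar Z D (insert i s) := by
    nlinarith [sq_nonneg (Z (D i) - r), sq_nonneg (empMean Z D s - r)]
  have hw := empVar_nonneg Z D (insert i s)
  by_contra hcon
  push Not at hcon
  nlinarith

/-- All radii stay at least half the error level, also after termination. -/
lemma half_le_ciRadius (hK : 1 ≤ K) (hδ : 0 < δ) (hδ1 : δ ≤ 1) (hε : 0 < ε)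
    (hA : IsCellPartition A) (hn : n ≠ 0) {m : ℕ} (hm : (m : ℝ) ≤ 1 / ε)
    (hshare : ∀ j, ε ≤ share A D j) (t : ℕ) :
    ENNReal.ofReal (ε / 2) ≤ ciRadius Z A δ D (evaluatedSet Z A δ D ε m t) := by
  induction t with
  | zero =>
    set S := evaluatedSet Z A δ D ε m 0 with hS
    -- After the warm start a cell has at most 1/ε points, so its radius, at least 4/t, exceeds ε.
    have h1 : ∀ k, ENNReal.ofReal ε ≤ groupRadius Z A δ D S k := by
      intro k
      rw [groupRadius]
      split_ifs with h0
      · exact le_top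
      · have hc1 : (1 : ℝ) ≤ (seen A D S k).card := by
          exact_mod_cast Nat.one_le_iff_ne_zero.mpr h0
        have hcm : ((seen A D S k).card : ℝ) ≤ 1 / ε := by
          refine le_trans ?_ hm
          have : (seen A D S k).card ≤ S.card :=
            Finset.card_le_card fun i hi => (mem_seen.mp hi).1
          exact_mod_cast this.trans (card_evaluatedSet_zero_le m)
        refine ENNReal.ofReal_le_ofReal
          (le_trans ?_ (div_le_radiusFn hK hδ hδ1 groupVar_nonneg hc1))
        rw [le_div_iff₀ hε] at hcm
        rw [le_div_iff₀ (by linarith)]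
        linarith
    calc ENNReal.ofReal (ε / 2) ≤ ENNReal.ofReal (∑ k, share A D k * ε) := by
          rw [← Finset.sum_mul, sum_share hA hn]
          exact ENNReal.ofReal_le_ofReal (by linarith)
      _ = ∑ k, ENNReal.ofReal (share A D k) * ENNReal.ofReal ε := by
          rw [ENNReal.ofReal_sum_of_nonneg fun j _ => mul_nonneg share_nonneg hε.le]
          exact Finset.sum_congr rfl fun j _ => ENNReal.ofReal_mul share_nonneg
      _ ≤ _ := Finset.sum_le_sum fun k _ => mul_le_mul_right (h1 k) _
  | succ t ih =>
    by_cases h : IsDone Z A δ D (evaluatedSet Z A δ D ε m t) ε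
    · rw [evaluatedSet, step_of_isDone h]; exact ih
    obtain ⟨i, k, hi, hik, -, -, hst⟩ := step_of_not_isDone hA h
    rw [evaluatedSet, hst]
    set S := evaluatedSet Z A δ D ε m t
    obtain ⟨h1, h2⟩ := seen_insert_self (A := A) hi hik
    have hc := Finset.card_insert_of_notMem h2
    by_cases h0 : (seen A D S k).card = 0
    -- The first evaluation of a cell makes its radius finite, but still at least 1, and its share
    -- is at least ε.
    · have hc1 : (seen A D (insert i S) k).card = 1 := by rw [h1, hc, h0]
      have h3 : ENNReal.ofReal 1 ≤ groupRadius Z A δ D (insert i S) k := by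
        rw [groupRadius, if_neg (by omega), hc1]
        refine ENNReal.ofReal_le_ofReal (le_trans ?_
          (div_le_radiusFn hK hδ hδ1 groupVar_nonneg (by norm_num)))
        norm_num
      calc ENNReal.ofReal (ε / 2) ≤ ENNReal.ofReal (share A D k * 1) :=
            ENNReal.ofReal_le_ofReal (by linarith [hshare k])
        _ = ENNReal.ofReal (share A D k) * ENNReal.ofReal 1 := ENNReal.ofReal_mul share_nonneg
        _ ≤ ENNReal.ofReal (share A D k) * groupRadius Z A δ D (insert i S) k :=
            mul_le_mul_right h3 _
        _ ≤ _ := Finset.single_le_sum (f := fun k =>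
            ENNReal.ofReal (share A D k) * groupRadius Z A δ D (insert i S) k)
            (fun _ _ => zero_le) (Finset.mem_univ k)
    -- A round takes place only while the total radius exceeds ε, and one more point at most halves
    -- a cell radius.
    · have h3 : ∀ j, ENNReal.ofReal (1 / 2) * groupRadius Z A δ D S j ≤
          groupRadius Z A δ D (insert i S) j := by
        intro j
        by_cases hj : j = k
        · subst hj
          rw [groupRadius, groupRadius, if_neg h0, h1, hc, if_neg (by omega),
            ← ENNReal.ofReal_mul (by norm_num)]
          refine ENNReal.ofReal_le_ofReal ?_
          have := radiusFn_half_le hK hδ hδ1 groupVar_nonneg (groupVar_half_le (Z := Z) hi hik h0)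
            (by exact_mod_cast Nat.one_le_iff_ne_zero.mpr h0 : (1 : ℝ) ≤ (seen A D S j).card)
          push_cast
          linarith
        · have e := seen_insert_of_ne (S := S) hA hik hj
          have : groupRadius Z A δ D (insert i S) j = groupRadius Z A δ D S j := by
            simp only [groupRadius, groupVar, groupMean, e]
          rw [this]
          refine mul_le_of_le_one_left' ?_
          rw [← ENNReal.ofReal_one]
          exact ENNReal.ofReal_le_ofReal (by norm_num)
      have h4 : ENNReal.ofReal ε ≤ ciRadius Z A δ D S := by
        have := fun hh => h (Or.inl hh)
        exact (not_le.mp this).le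
      calc ENNReal.ofReal (ε / 2) = ENNReal.ofReal (1 / 2) * ENNReal.ofReal ε := by
            rw [← ENNReal.ofReal_mul (by norm_num)]; congr 1; ring
        _ ≤ ENNReal.ofReal (1 / 2) * ciRadius Z A δ D S := mul_le_mul_right h4 _
        _ = ∑ j, ENNReal.ofReal (share A D j) *
            (ENNReal.ofReal (1 / 2) * groupRadius Z A δ D S j) := by
            rw [ciRadius, Finset.mul_sum]
            exact Finset.sum_congr rfl fun j _ => by ring
        _ ≤ _ := Finset.sum_le_sum fun j _ => mul_le_mul_right (h3 j) _

/-- Validity of all confidence intervals, given that of the cells up to a constant factor. -/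
lemma abs_estimate_sub_le {r : Fin K → ℝ} {R : ℝ}
    (hshare : ∀ j, 0 < share A D j)
    (hcell : ∀ j, (seen A D S j).card ≠ 0 → |groupMean Z A D S j - r j| ≤
      19 / 20 * radiusFn K δ (groupVar Z A D S j) (seen A D S j).card)
    (hR : |∑ j, share A D j * r j - R| ≤ ε / 40)
    (hhalf : ENNReal.ofReal (ε / 2) ≤ ciRadius Z A δ D S) :
    ENNReal.ofReal |estimate Z A D S - R| ≤ ciRadius Z A δ D S := by
  by_cases h0 : ∃ j, (seen A D S j).card = 0
  · obtain ⟨j, hj⟩ := h0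
    have : ciRadius Z A δ D S = ⊤ := by
      rw [ciRadius, ENNReal.sum_eq_top]
      refine ⟨j, Finset.mem_univ j, ?_⟩
      rw [groupRadius, if_pos hj]
      exact ENNReal.mul_top (by simpa using hshare j)
    rw [this]; exact le_top
  · push Not at h0
    have h0' : ∀ j, (seen A D S j).card ≠ 0 := h0
    rw [ciRadius_eq_ofReal h0'] at hhalf ⊢
    rw [ENNReal.ofReal_le_ofReal_iff (Finset.sum_nonneg fun j _ =>
      mul_nonneg share_nonneg radiusFn_nonneg)] at hhalf
    refine ENNReal.ofReal_le_ofReal ?_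
    have e : estimate Z A D S - R = ∑ j, share A D j * (groupMean Z A D S j - r j) +
        (∑ j, share A D j * r j - R) := by
      simp only [mul_sub, Finset.sum_sub_distrib, estimate]; ring
    have h1 : |∑ j, share A D j * (groupMean Z A D S j - r j)| ≤ 19 / 20 *
        ∑ j, share A D j * radiusFn K δ (groupVar Z A D S j) (seen A D S j).card := by
      rw [Finset.mul_sum]
      refine (Finset.abs_sum_le_sum_abs _ _).trans (Finset.sum_le_sum fun j _ => ?_)
      rw [abs_mul, abs_of_pos (hshare j)]
      have := mul_le_mul_of_nonneg_left (hcell j (h0' j)) (hshare j).le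
      linarith
    rw [e]
    -- ε/40 is at most 1/20 of the total radius, which is at least ε/2.
    refine (abs_add_le _ _).trans ?_
    linarith

end Deterministic

/-! ### The equally spaced partition -/

section EqualCell

variable {E : Type*} {Z : E → ℝ} {K : ℕ}

lemma equalCell_subset (hK : 1 ≤ K) {k : Fin K} {x : E} (hx : x ∈ equalCell Z K k) :
    Z x ∈ Set.Icc ((k : ℝ) / K) (((k : ℝ) + 1) / K) := by
  refine ⟨hx.1, ?_⟩
  rcases hx.2 with h | ⟨h1, h2⟩
  · exact h.le
  · have hK0 : (0 : ℝ) < K := by exact_mod_cast hK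
    have : (k : ℝ) + 1 = K := by exact_mod_cast h1
    rw [h2, this, div_self hK0.ne']

lemma isCellPartition_equalCell (hK : 1 ≤ K) (h01 : ∀ x, Z x ∈ Set.Icc (0 : ℝ) 1) :
    IsCellPartition (equalCell Z K) := by
  have hK0 : (0 : ℝ) < K := by exact_mod_cast hK
  refine ⟨fun x => ?_, ?_⟩
  · obtain ⟨h0, h1⟩ := h01 x
    rcases h1.lt_or_eq with h | h
    · have hf : ⌊Z x * K⌋₊ < K := by
        rw [Nat.floor_lt (by positivity)]; nlinarith
      refine ⟨⟨⌊Z x * K⌋₊, hf⟩, ?_, Or.inl ?_⟩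
      · rw [div_le_iff₀ hK0]; exact Nat.floor_le (by positivity)
      · rw [lt_div_iff₀ hK0]; exact Nat.lt_floor_add_one _
    · refine ⟨⟨K - 1, by omega⟩, ?_, Or.inr ⟨by simp; omega, h⟩⟩
      rw [h, div_le_one hK0]
      simp
  · have key : ∀ x (j k : Fin K), x ∈ equalCell Z K j → x ∈ equalCell Z K k → j ≤ k := by
      rintro x j k ⟨hj, -⟩ ⟨-, hk⟩
      rcases hk with hk | ⟨hk, -⟩
      · have := (div_lt_div_iff_of_pos_right hK0).mp (hj.trans_lt hk)
        have h2 : (j : ℕ) < (k : ℕ) + 1 := by exact_mod_cast this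
        exact Fin.le_def.mpr (by omega)
      · have := j.isLt
        exact Fin.le_def.mpr (by omega)
    exact fun x j k hj hk => le_antisymm (key x j k hj hk) (key x k j hk hj)

lemma measurableSet_equalCell [MeasurableSpace E] (hZ : Measurable Z) (k : Fin K) :
    MeasurableSet (equalCell Z K k) := by
  refine MeasurableSet.inter (measurableSet_le measurable_const hZ)
    (MeasurableSet.union (measurableSet_lt hZ measurable_const) ?_)
  exact MeasurableSet.inter (MeasurableSet.const _) (hZ (measurableSet_singleton 1))

lemma groupVar_equalCell_le (hK : 1 ≤ K) {n : ℕ} (D : Fin n → E) (S : Finset (Fin n))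
    (k : Fin K) : groupVar Z (equalCell Z K) D S k ≤ 1 / (K : ℝ) ^ 2 := by
  have hK0 : (0 : ℝ) < K := by exact_mod_cast hK
  by_cases h0 : (seen (equalCell Z K) D S k).card = 0
  · rw [groupVar, h0]; simp
  have hc : (0 : ℝ) < (seen (equalCell Z K) D S k).card := by
    exact_mod_cast Nat.pos_of_ne_zero h0
  have hmem : ∀ i ∈ seen (equalCell Z K) D S k,
      Z (D i) ∈ Set.Icc ((k : ℝ) / K) (((k : ℝ) + 1) / K) :=
    fun i hi => equalCell_subset hK (mem_seen.mp hi).2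
  have hm1 : (k : ℝ) / K ≤ groupMean Z (equalCell Z K) D S k := by
    rw [groupMean, le_div_iff₀ hc, mul_comm, ← nsmul_eq_mul]
    exact Finset.card_nsmul_le_sum _ _ _ fun i hi => (hmem i hi).1
  have hm2 : groupMean Z (equalCell Z K) D S k ≤ ((k : ℝ) + 1) / K := by
    rw [groupMean, div_le_iff₀ hc, mul_comm, ← nsmul_eq_mul]
    exact Finset.sum_le_card_nsmul _ _ _ fun i hi => (hmem i hi).2
  rw [groupVar, div_le_iff₀ hc, mul_comm, ← nsmul_eq_mul]
  refine Finset.sum_le_card_nsmul _ _ _ fun i hi => ?_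
  obtain ⟨h1, h2⟩ := hmem i hi
  have e : ((k : ℝ) + 1) / K = (k : ℝ) / K + 1 / K := by ring
  rw [e] at h2 hm2
  rw [← one_div_pow]
  exact sq_le_sq' (by linarith) (by linarith)

variable [MeasurableSpace E] {P : Measure E} [IsProbabilityMeasure P]

lemma cellVar_equalCell_le (hK : 1 ≤ K) (hZ : Measurable Z) {k : Fin K}
    (hP : 0 < P.real (equalCell Z K k)) :
    cellVar P Z (equalCell Z K) k ≤ 1 / (K : ℝ) ^ 2 := by
  have hne : P (equalCell Z K k) ≠ 0 := fun h => by simp [Measure.real, h] at hP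
  have := cond_isProbabilityMeasure hne
  have hK0 : (0 : ℝ) < K := by exact_mod_cast hK
  have h1 : ∀ᵐ x ∂P[|equalCell Z K k], Z x ∈ Set.Icc ((k : ℝ) / K) (((k : ℝ) + 1) / K) := by
    filter_upwards [ae_cond_mem (μ := P) (measurableSet_equalCell hZ k)] with x hx
    exact equalCell_subset hK hx
  refine (variance_le_sq_of_bounded h1 hZ.aemeasurable).trans (le_of_le_of_eq
    (b := (1 / (K : ℝ)) ^ 2) ?_ (one_div_pow _ _))
  have e : ((k : ℝ) + 1) / K - (k : ℝ) / K = 1 / K := by ring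
  rw [e]
  have : (0 : ℝ) < 1 / K := by positivity
  nlinarith

/-- On [0, 1] the lower bound for the density is smallest at z = 1. -/
lemma le_measureReal_equalCell (hK : 1 ≤ K) (hZ : Measurable Z) {A σ : ℝ} (hA : 0 < A)
    (h : HasSuperGaussianLoss P Z A σ) (k : Fin K) :
    A * Real.exp (-1 / σ ^ 2) / K ≤ P.real (equalCell Z K k) := by
  obtain ⟨f, hf, hmap, hle⟩ := h
  have hK0 : (0 : ℝ) < K := by exact_mod_cast hK
  set I := Set.Ico ((k : ℝ) / K) (((k : ℝ) + 1) / K) with hI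
  have hsub : Z ⁻¹' I ⊆ equalCell Z K k := fun x hx => ⟨hx.1, Or.inl hx.2⟩
  have h1 : ENNReal.ofReal (A * Real.exp (-1 / σ ^ 2) / K) ≤ P (equalCell Z K k) := by
    calc _ = ∫⁻ _ in I, ENNReal.ofReal (A * Real.exp (-1 / σ ^ 2)) := by
          rw [setLIntegral_const, hI, Real.volume_Ico, ← ENNReal.ofReal_mul (by positivity)]
          congr 1; ring
      _ ≤ ∫⁻ z in I, ENNReal.ofReal (f z) := by
          refine setLIntegral_mono hf.ennreal_ofReal fun z hz => ENNReal.ofReal_le_ofReal ?_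
          have hz0 : 0 ≤ z := le_trans (by positivity) hz.1
          have hz1 : z ≤ 1 := by
            refine hz.2.le.trans ?_
            rw [div_le_one hK0]
            exact_mod_cast k.isLt
          refine le_trans ?_ (hle z ⟨hz0, hz1⟩)
          refine mul_le_mul_of_nonneg_left (Real.exp_le_exp.mpr ?_) hA.le
          exact div_le_div_of_nonneg_right (by nlinarith) (sq_nonneg σ)
      _ = P.map Z I := by rw [hmap, withDensity_apply _ measurableSet_Ico]
      _ = P (Z ⁻¹' I) := Measure.map_apply hZ measurableSet_Ico
      _ ≤ _ := measure_mono hsub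
  exact (ENNReal.ofReal_le_iff_le_toReal (measure_ne_top _ _)).mp h1

end EqualCell

/-! ### Concentration of the cell counts and of the between-cell error -/

section Concentration

variable {E : Type*} [MeasurableSpace E] {P : Measure E} [IsProbabilityMeasure P]

/-- Chernoff bound with tilt -1: exp(-1) ≤ 2/5 makes the moment at most 1 - 3p/5, and 3/5 - 1/2 =
1/10 remains in the exponent. -/
lemma measure_card_lt_half {K n : ℕ} {A : Fin K → Set E} (k : Fin K) (hA : MeasurableSet (A k))
    (hn : n ≠ 0) :
    (Measure.pi fun _ : Fin n => P) {D | share A D k < P.real (A k) / 2} ≤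
      ENNReal.ofReal (Real.exp (-(n * P.real (A k) / 10))) := by
  classical
  set p := P.real (A k) with hp
  set φ : E → ℝ := fun x => 3 / 5 * p + (A k).indicator (fun _ => (-1 : ℝ)) x with hφ
  have hφm : Measurable φ := measurable_const.add (measurable_const.indicator hA)
  have he : Real.exp (-1) ≤ 2 / 5 := by
    rw [Real.exp_neg, inv_le_comm₀ (Real.exp_pos _) (by norm_num)]
    linarith [Real.exp_one_gt_d9]
  have hmom : ∫⁻ x, ENNReal.ofReal (Real.exp (φ x)) ∂P ≤ 1 := by
    have hi : Integrable (fun x => 1 + (A k).indicator (fun _ => (-3 / 5 : ℝ)) x) P :=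
      (integrable_const _).add ((integrable_const _).indicator hA)
    refine lintegral_exp_le_one P (hi.const_mul (Real.exp (3 / 5 * p)))
      (Filter.Eventually.of_forall fun x => ?_) ?_
    · rw [hφ]
      simp only [Real.exp_add]
      refine mul_le_mul_of_nonneg_left ?_ (Real.exp_nonneg _)
      by_cases hx : x ∈ A k
      · simp only [Set.indicator_of_mem hx]; linarith
      · simp [Set.indicator_of_notMem hx]
    · rw [integral_const_mul, integral_add (integrable_const _)
        ((integrable_const _).indicator hA), integral_indicator hA]
      simp only [integral_const, MeasurableSet.univ, measureReal_restrict_apply, Set.univ_inter,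
        smul_eq_mul, probReal_univ, mul_one]
      have h1 := Real.add_one_le_exp (-(3 / 5 * p))
      calc _ ≤ Real.exp (3 / 5 * p) * Real.exp (-(3 / 5 * p)) :=
            mul_le_mul_of_nonneg_left (by linarith) (Real.exp_nonneg _)
        _ = 1 := by rw [← Real.exp_add]; simp
  refine (measure_mono fun D hD => ?_).trans (measure_crossing_le P hφm hmom n _)
  refine ⟨n, le_rfl, ?_⟩
  have h1 : ∀ j : Fin n, (if (j : ℕ) < n then φ (D j) else 0) = φ (D j) := fun j => by
    simp [j.isLt]
  rw [Finset.sum_congr rfl fun j _ => h1 j]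
  simp only [hφ, Finset.sum_add_distrib, Finset.sum_const, Finset.card_univ, Fintype.card_fin,
    nsmul_eq_mul]
  have h2 : ∑ j : Fin n, (A k).indicator (fun _ => (-1 : ℝ)) (D j) = -((group A D k).card : ℝ) := by
    simp only [Set.indicator_apply, group, Finset.sum_ite, Finset.sum_const, nsmul_eq_mul]
    simp
  rw [h2]
  have hn0 : (0 : ℝ) < n := by exact_mod_cast Nat.pos_of_ne_zero hn
  have h3 : ((group A D k).card : ℝ) / n < p / 2 := hD
  rw [div_lt_iff₀ hn0] at h3
  linarith

lemma measure_abs_mean_sub_gt {n : ℕ} (hn : n ≠ 0) {ρ : E → ℝ} (hρ : Measurable ρ)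
    (h01 : ∀ x, ρ x ∈ Set.Icc (0 : ℝ) 1) {s : ℝ} (hs : 0 ≤ s) (hs1 : s ≤ 1) :
    (Measure.pi fun _ : Fin n => P) {D | s < |(∑ i, ρ (D i)) / n - ∫ x, ρ x ∂P|} ≤
      ENNReal.ofReal (2 * Real.exp (-(n * s ^ 2 / 2))) := by
  have hn0 : (0 : ℝ) < n := by exact_mod_cast Nat.pos_of_ne_zero hn
  have hu : P.real Set.univ = 1 := probReal_univ
  have hpos : 0 < P.real Set.univ := by rw [hu]; norm_num
  have hv := cellVariance_le hρ h01 hpos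
  have hm : cellMean P ρ Set.univ = ∫ x, ρ x ∂P := by
    rw [cellMean, hu, Measure.restrict_univ, div_one]
  set v := cellVariance P ρ Set.univ
  -- With tilt e·s the exponent is at least ns²(1 - 3v/4) ≥ ns²/2, as v ≤ 1/4.
  have hb : ∀ e : ℝ, |e| = 1 → (Measure.pi fun _ : Fin n => P)
      {D | n * s ≤ e * ∑ i, (ρ (D i) - ∫ x, ρ x ∂P)} ≤
        ENNReal.ofReal (Real.exp (-(n * s ^ 2 / 2))) := by
    intro e he
    have h1 : |e * s| ≤ 1 := by rw [abs_mul, he, one_mul, abs_of_nonneg hs]; exact hs1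
    have h2 := lintegral_exp_mean MeasurableSet.univ hρ h01 hpos h1
    simp only [Set.indicator_univ, hm] at h2
    refine (measure_mono fun D hD => ?_).trans (measure_crossing_le P (by fun_prop) h2 n _)
    refine ⟨n, le_rfl, ?_⟩
    have h3 : ∀ j : Fin n, (if (j : ℕ) < n then
        e * s * (ρ (D j) - ∫ x, ρ x ∂P) - 3 / 4 * (e * s) ^ 2 * v else 0) =
        e * s * (ρ (D j) - ∫ x, ρ x ∂P) - 3 / 4 * (e * s) ^ 2 * v := fun j => by
      simp [j.isLt]
    rw [Finset.sum_congr rfl fun j _ => h3 j, Finset.sum_sub_distrib, ← Finset.mul_sum,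
      Finset.sum_const, Finset.card_univ, Fintype.card_fin, nsmul_eq_mul]
    have he2 : e ^ 2 = 1 := by rw [← sq_abs, he]; norm_num
    have hD' : s * (n * s) ≤ s * (e * ∑ i, (ρ (D i) - ∫ x, ρ x ∂P)) :=
      mul_le_mul_of_nonneg_left hD hs
    rw [mul_pow, he2]
    have h5 : n * s ^ 2 * v ≤ n * s ^ 2 * (1 / 4) :=
      mul_le_mul_of_nonneg_left hv (by positivity)
    have h6 : 0 ≤ n * s ^ 2 := by positivity
    linarith
  refine (measure_mono (t := {D : Fin n → E | n * s ≤ 1 * ∑ i, (ρ (D i) - ∫ x, ρ x ∂P)} ∪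
    {D | n * s ≤ -1 * ∑ i, (ρ (D i) - ∫ x, ρ x ∂P)}) fun D hD => ?_).trans ?_
  · have hD' : s < |(∑ i, ρ (D i)) / n - ∫ x, ρ x ∂P| := hD
    have e : (∑ i, ρ (D i)) / n - ∫ x, ρ x ∂P = (∑ i, (ρ (D i) - ∫ x, ρ x ∂P)) / n := by
      rw [Finset.sum_sub_distrib, Finset.sum_const, Finset.card_univ, Fintype.card_fin,
        nsmul_eq_mul]
      field_simp
    rw [e, abs_div, abs_of_pos hn0, lt_div_iff₀ hn0] at hD'
    simp only [Set.mem_union, Set.mem_ofPred_eq]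
    rcases abs_cases (∑ i, (ρ (D i) - ∫ x, ρ x ∂P)) with ⟨h, _⟩ | ⟨h, _⟩ <;> rw [h] at hD'
    · left; linarith
    · right; linarith
  · refine (measure_union_le _ _).trans ((add_le_add (hb 1 (by simp)) (hb (-1) (by simp))).trans ?_)
    rw [← ENNReal.ofReal_add (Real.exp_nonneg _) (Real.exp_nonneg _), two_mul]

/-- Replacing the loss by its cell mean keeps the expectation, and the empirical shares concentrate
around the probabilities of the cells. -/
lemma measure_abs_sum_share_sub_gt {K n : ℕ} (hn : n ≠ 0) {Z : E → ℝ} {A : Fin K → Set E}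
    (hA : IsCellPartition A) (hAm : ∀ k, MeasurableSet (A k)) (hZ : Measurable Z)
    (h01 : ∀ x, Z x ∈ Set.Icc (0 : ℝ) 1) (hP : ∀ k, 0 < P.real (A k)) {s : ℝ} (hs : 0 ≤ s)
    (hs1 : s ≤ 1) :
    (Measure.pi fun _ : Fin n => P)
      {D | s < |∑ k, share A D k * cellMean P Z (A k) - ∫ x, Z x ∂P|} ≤
        ENNReal.ofReal (2 * Real.exp (-(n * s ^ 2 / 2))) := by
  classical
  set r : Fin K → ℝ := fun k => cellMean P Z (A k)
  set ρ : E → ℝ := fun x => ∑ k, (A k).indicator (fun _ => r k) x with hρ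
  have hρm : Measurable ρ := Finset.measurable_fun_sum _ fun k _ =>
    measurable_const.indicator (hAm k)
  have hind : ∀ (g : Fin K → E → ℝ) x k, x ∈ A k → ∑ j, (A j).indicator (g j) x = g k x := by
    intro g x k hx
    rw [Finset.sum_eq_single k]
    · exact Set.indicator_of_mem hx _
    · intro j _ hj
      exact Set.indicator_of_notMem (fun h => hj (hA.disjoint _ _ _ h hx)) _
    · simp
  have hρ01 : ∀ x, ρ x ∈ Set.Icc (0 : ℝ) 1 := fun x => by
    obtain ⟨k, hk⟩ := hA.cover x
    rw [hρ]
    simp only [hind (fun k _ => r k) x k hk]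
    exact cellMean_mem_Icc hZ h01 (hP k)
  have hint : ∫ x, ρ x ∂P = ∫ x, Z x ∂P := by
    have hZi := integrable_of_mem_Icc (P := P) hZ h01
    have e1 : ∫ x, Z x ∂P = ∑ k, ∫ x in A k, Z x ∂P := by
      have : Z = fun x => ∑ k, (A k).indicator Z x := by
        ext x
        obtain ⟨k, hk⟩ := hA.cover x
        exact (hind (fun _ => Z) x k hk).symm
      conv_lhs => rw [this]
      rw [integral_finsetSum _ fun k _ => hZi.indicator (hAm k)]
      exact Finset.sum_congr rfl fun k _ => integral_indicator (hAm k)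
    rw [e1, hρ, integral_finsetSum _ fun k _ => (integrable_const _).indicator (hAm k)]
    refine Finset.sum_congr rfl fun k _ => ?_
    rw [integral_indicator (hAm k), integral_const, measureReal_restrict_apply MeasurableSet.univ,
      Set.univ_inter, smul_eq_mul]
    simp only [r, cellMean]
    have := (hP k).ne'
    field_simp
  have h := measure_abs_mean_sub_gt (P := P) hn hρm hρ01 hs hs1
  rw [hint] at h
  refine le_trans (le_of_eq ?_) h
  congr 1
  ext D
  have e : ∑ k, share A D k * r k = (∑ i, ρ (D i)) / n := by
    simp only [hρ]
    rw [Finset.sum_comm, Finset.sum_div]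
    refine Finset.sum_congr rfl fun k _ => ?_
    have : ∑ i, (A k).indicator (fun _ => r k) (D i) = (group A D k).card * r k := by
      simp only [Set.indicator_apply, group, Finset.sum_ite, Finset.sum_const, nsmul_eq_mul]
      simp
    rw [this, share]; ring
  simp only [Set.mem_ofPred_eq]
  rw [← e]

end Concentration

/-! ### Certification with the equally spaced partition -/

lemma exp_neg_baseComplexity_le {ε δ : ℝ} (hε : IsSmall ε) (hδ : 0 < δ) :
    Real.exp (-(Real.log (1 / δ) + Real.log (Real.log (1 / ε)))) ≤ δ / 8 := by
  have hl := hε.le_log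
  have hl0 : 0 < Real.log (1 / ε) := by linarith
  rw [neg_add, Real.exp_add, Real.exp_neg (Real.log (Real.log (1 / ε))), Real.exp_log hl0,
    one_div, Real.log_inv, neg_neg, Real.exp_log hδ, ← div_eq_mul_inv]
  exact div_le_div_of_nonneg_left hδ.le (by norm_num) (by linarith)

/-- The parameters of the equally spaced partition for which every cell has enough mass, where `κ`
bounds the conditional variances. -/
structure Admissible {E : Type*} [MeasurableSpace E] (P : Measure E) (Z : E → ℝ)
    (K n : ℕ) (κ ε δ : ℝ) : Prop where
  measurable : Measurable Z
  mem_Icc : ∀ x, Z x ∈ Set.Icc (0 : ℝ) 1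
  small : IsSmall ε
  delta_pos : 0 < δ
  delta_le : δ ≤ 1
  one_le : 1 ≤ K
  le_inv : (K : ℝ) ≤ 1 / ε
  sq_le : ε ^ 2 ≤ κ ^ 3
  kappa_le : κ ≤ 1
  le_kappa : 1 / (K : ℝ) ^ 2 ≤ κ
  size : 54000 * baseComplexity ε δ ≤ n
  mass : ∀ k, Real.log ((K : ℝ) + 1) * κ ≤ P.real (equalCell Z K k)

namespace Admissible

variable {E : Type*} [MeasurableSpace E] {P : Measure E} {Z : E → ℝ} {K n : ℕ} {κ ε δ : ℝ}

lemma kappa_pos (h : Admissible P Z K n κ ε δ) : 0 < κ := by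
  have hK : (0 : ℝ) < K := by exact_mod_cast h.one_le
  exact lt_of_lt_of_le (by positivity) h.le_kappa

lemma le_kappa_div_ten (h : Admissible P Z K n κ ε δ) : ε ≤ κ / 10 := by
  have h0 := h.small.pos
  have h1 := h.small.le_inv
  have hκ := h.kappa_pos
  have : ε ^ 3 ≤ (κ / 10) ^ 3 := by
    have := h.sq_le
    nlinarith [sq_nonneg ε]
  exact le_of_pow_le_pow_left₀ (by norm_num) (by positivity) this

lemma mass_pos (h : Admissible P Z K n κ ε δ) (k : Fin K) : 0 < P.real (equalCell Z K k) :=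
  lt_of_lt_of_le (mul_pos (by linarith [le_log_add_one h.one_le]) h.kappa_pos) (h.mass k)

lemma twelve_le (h : Admissible P Z K n κ ε δ) :
    12 ≤ Real.log (1 / δ) + Real.log (Real.log (1 / ε)) := by
  have h4 : 0 ≤ Real.log (1 / δ) :=
    Real.log_nonneg (by rw [le_div_iff₀ h.delta_pos]; linarith [h.delta_le])
  linarith [h.small.le_loglog]

lemma size_mul (h : Admissible P Z K n κ ε δ) :
    54000 * (Real.log (1 / δ) + Real.log (Real.log (1 / ε))) ≤ n * ε ^ 2 := by
  have h0 := h.small.pos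
  have := h.size
  rw [baseComplexity, ← mul_div_assoc, div_le_iff₀ (by positivity)] at this
  exact this

lemma size_pos (h : Admissible P Z K n κ ε δ) : (0 : ℝ) < n := by
  have h1 := h.size_mul
  have h2 := h.twelve_le
  have h0 := h.small.pos
  by_contra hn
  push Not at hn
  have : (n : ℝ) * ε ^ 2 ≤ 0 := mul_nonpos_of_nonpos_of_nonneg hn (sq_nonneg ε)
  linarith

lemma size_ne (h : Admissible P Z K n κ ε δ) : n ≠ 0 := by
  rintro rfl
  simpa using h.size_pos

/-- Here 54000 = 4 · 13500: four times the complexity is expected in each cell, so half of the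
expected count still exceeds its ceiling. -/
lemma cellComplexity_mul_le (h : Admissible P Z K n κ ε δ) :
    4 * cellComplexity K κ ε δ ≤ n * (Real.log ((K : ℝ) + 1) * κ) := by
  have h0 := h.small.pos
  have h1 := h.size_mul
  have hΛ := le_log_add_one h.one_le
  rw [cellComplexity, ← mul_div_assoc, div_le_iff₀ (by positivity)]
  have := mul_le_mul_of_nonneg_right h1
    (mul_nonneg (by linarith : 0 ≤ Real.log ((K : ℝ) + 1)) h.kappa_pos.le)
  linarith

lemma one_le_complexity (h : Admissible P Z K n κ ε δ) : 1 ≤ cellComplexity K κ ε δ :=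
  one_le_cellComplexity h.one_le h.small h.delta_pos h.delta_le h.kappa_pos h.sq_le h.kappa_le

/-- Absorbs the warm start m ≤ 1/ε into the cost. -/
lemma inv_le_complexity (h : Admissible P Z K n κ ε δ) : 1 / ε ≤ cellComplexity K κ ε δ := by
  have h0 := h.small.pos
  have h1 := h.le_kappa_div_ten
  have h2 := h.twelve_le
  have hΛ := le_log_add_one h.one_le
  rw [cellComplexity, div_le_div_iff₀ h0 (by positivity)]
  have h3 : 1 ≤ (Real.log (1 / δ) + Real.log (Real.log (1 / ε))) * Real.log ((K : ℝ) + 1) := by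
    nlinarith
  have h4 : κ ≤ 13500 * ((Real.log (1 / δ) + Real.log (Real.log (1 / ε))) *
      Real.log ((K : ℝ) + 1)) * κ := by
    have := mul_le_mul_of_nonneg_right h3 h.kappa_pos.le
    have := h.kappa_pos
    linarith
  have h5 : ε ≤ 13500 * ((Real.log (1 / δ) + Real.log (Real.log (1 / ε))) *
      Real.log ((K : ℝ) + 1)) * κ := by linarith
  nlinarith

variable [IsProbabilityMeasure P]

/-- All cells contain at least half of the expected number of points, with high probability. -/
lemma measure_share_lt (h : Admissible P Z K n κ ε δ) :
    (Measure.pi fun _ : Fin n => P)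
      {D | ∃ k, share (equalCell Z K) D k < P.real (equalCell Z K k) / 2} ≤
        ENNReal.ofReal (δ / 8) := by
  have h0 := h.small.pos
  have hκ := h.kappa_pos
  have hQ := exp_neg_baseComplexity_le h.small h.delta_pos
  have h12 := h.twelve_le
  have hs := h.size_mul
  have hΛ := le_log_add_one h.one_le
  set Q := Real.log (1 / δ) + Real.log (Real.log (1 / ε)) with hQdef
  have hexp : ∀ k, Real.exp (-(n * P.real (equalCell Z K k) / 10)) ≤ ε * (δ / 8) := by
    intro k
    have h1 : n * (69 / 100 * κ) ≤ n * P.real (equalCell Z K k) := by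
      refine mul_le_mul_of_nonneg_left (le_trans ?_ (h.mass k)) h.size_pos.le
      exact mul_le_mul_of_nonneg_right hΛ hκ.le
    have h2 : 54000 * Q * (1 / ε) ≤ n * κ := by
      have e : 54000 * Q ≤ n * κ * ε := by
        refine hs.trans ?_
        have : n * ε * ε ≤ n * κ * ε := by
          have := h.le_kappa_div_ten
          have := h.size_pos
          gcongr
          linarith
        linarith
      rw [← mul_div_assoc, mul_one, div_le_iff₀ h0]
      exact e
    -- The additional factor exp(-1/ε) ≤ ε pays for the union over K ≤ 1/ε cells.
    have h3 : Q + 1 / ε ≤ n * P.real (equalCell Z K k) / 10 := by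
      have e1 : 1 ≤ 1 / ε := by
        rw [le_div_iff₀ h0]; linarith [h.small.le_inv]
      have e2 : Q * 1 ≤ Q * (1 / ε) := mul_le_mul_of_nonneg_left e1 (by linarith)
      have e3 : 12 * (1 / ε) ≤ Q * (1 / ε) := mul_le_mul_of_nonneg_right h12 (by linarith)
      linarith
    calc _ ≤ Real.exp (-(1 / ε) + -Q) := Real.exp_le_exp.mpr (by linarith)
      _ = Real.exp (-(1 / ε)) * Real.exp (-Q) := Real.exp_add _ _
      _ ≤ ε * (δ / 8) := by
        refine mul_le_mul ?_ hQ (Real.exp_nonneg _) h0.le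
        have := Real.add_one_le_exp (1 / ε)
        rw [Real.exp_neg, inv_le_comm₀ (Real.exp_pos _) h0, ← one_div]
        linarith
  have hsub : {D : Fin n → E | ∃ k, share (equalCell Z K) D k < P.real (equalCell Z K k) / 2} ⊆
      ⋃ k ∈ (Finset.univ : Finset (Fin K)),
        {D | share (equalCell Z K) D k < P.real (equalCell Z K k) / 2} := by
    rintro D ⟨k, hk⟩
    exact Set.mem_biUnion (Finset.mem_coe.mpr (Finset.mem_univ k)) hk
  have hδ := h.delta_pos
  calc _ ≤ ∑ _k : Fin K, ENNReal.ofReal (ε * (δ / 8)) :=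
        (measure_mono hsub).trans ((measure_biUnion_finset_le _ _).trans
          (Finset.sum_le_sum fun k _ => (measure_card_lt_half k
            (measurableSet_equalCell h.measurable k) h.size_ne).trans
              (ENNReal.ofReal_le_ofReal (hexp k))))
    _ = ENNReal.ofReal (K * (ε * (δ / 8))) := by
        rw [← ENNReal.ofReal_sum_of_nonneg fun _ _ => by positivity]
        simp
    _ ≤ _ := by
        refine ENNReal.ofReal_le_ofReal ?_
        have : K * ε ≤ 1 := by
          have := h.le_inv
          rwa [le_div_iff₀ h0] at this
        calc _ = K * ε * (δ / 8) := by ring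
          _ ≤ 1 * (δ / 8) := mul_le_mul_of_nonneg_right this (by positivity)
          _ = _ := one_mul _

lemma measure_between_gt (h : Admissible P Z K n κ ε δ) :
    (Measure.pi fun _ : Fin n => P)
      {D | ε / 40 < |∑ k, share (equalCell Z K) D k * cellMean P Z (equalCell Z K k) -
        ∫ x, Z x ∂P|} ≤ ENNReal.ofReal (δ / 4) := by
  have h0 := h.small.pos
  have hQ := exp_neg_baseComplexity_le h.small h.delta_pos
  have h12 := h.twelve_le
  have hs := h.size_mul
  refine (measure_abs_sum_share_sub_gt h.size_ne (isCellPartition_equalCell h.one_le h.mem_Icc)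
    (measurableSet_equalCell h.measurable) h.measurable h.mem_Icc h.mass_pos (by positivity)
    (by linarith [h.small.le_inv])).trans (ENNReal.ofReal_le_ofReal ?_)
  -- n(ε/40)²/2 ≥ (54000/3200)Q ≥ Q.
  have := Real.exp_le_exp.mpr (show -((n : ℝ) * (ε / 40) ^ 2 / 2) ≤
    -(Real.log (1 / δ) + Real.log (Real.log (1 / ε))) by
      rw [div_pow]; linarith)
  linarith

lemma measure_cells_gt (h : Admissible P Z K n κ ε δ) :
    (Measure.pi fun _ : Fin n => P) {D | ∃ k i, (cellPrefix (equalCell Z K k) D i).card ≠ 0 ∧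
      19 / 20 * radiusFn K δ (empVar Z D (cellPrefix (equalCell Z K k) D i))
        (cellPrefix (equalCell Z K k) D i).card <
        |empMean Z D (cellPrefix (equalCell Z K k) D i) - cellMean P Z (equalCell Z K k)|} ≤
      ENNReal.ofReal (3 * δ / 8) := by
  have hK : (0 : ℝ) < K := by exact_mod_cast h.one_le
  have hδ := h.delta_pos
  have hsub : {D : Fin n → E | ∃ k i, (cellPrefix (equalCell Z K k) D i).card ≠ 0 ∧
      19 / 20 * radiusFn K δ (empVar Z D (cellPrefix (equalCell Z K k) D i))
        (cellPrefix (equalCell Z K k) D i).card <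
        |empMean Z D (cellPrefix (equalCell Z K k) D i) - cellMean P Z (equalCell Z K k)|} ⊆
      ⋃ k ∈ (Finset.univ : Finset (Fin K)), {D | ∃ i,
        (cellPrefix (equalCell Z K k) D i).card ≠ 0 ∧
        19 / 20 * radiusFn K δ (empVar Z D (cellPrefix (equalCell Z K k) D i))
        (cellPrefix (equalCell Z K k) D i).card <
        |empMean Z D (cellPrefix (equalCell Z K k) D i) - cellMean P Z (equalCell Z K k)|} := by
    rintro D ⟨k, hk⟩
    exact Set.mem_biUnion (Finset.mem_coe.mpr (Finset.mem_univ k)) hk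
  calc _ ≤ ∑ _k : Fin K, ENNReal.ofReal (3 * δ / (8 * K)) :=
        (measure_mono hsub).trans ((measure_biUnion_finset_le _ _).trans
          (Finset.sum_le_sum fun k _ => cell_confidence (measurableSet_equalCell h.measurable k)
            h.measurable h.mem_Icc (h.mass_pos k) h.one_le hδ h.delta_le n))
    _ = _ := by
        rw [← ENNReal.ofReal_sum_of_nonneg fun _ _ => by positivity]
        simp only [Finset.sum_const, Finset.card_univ, Fintype.card_fin, nsmul_eq_mul]
        congr 1
        field_simp

/-- The adaptive evaluation is certified, with a saving ratio of the order of `K κ ln (K + 1)`. -/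
theorem exists_equalCertified (h : Admissible P Z K n κ ε δ) {m : ℕ} (hm : (m : ℝ) ≤ 1 / ε) :
    ∃ n', EqualCertified P Z K n m ε δ n' ∧
      (n' : ℝ) / n ≤ 5 * (K * κ * Real.log ((K : ℝ) + 1)) := by
  have h0 := h.small.pos
  have hK : (1 : ℝ) ≤ K := by exact_mod_cast h.one_le
  have hA := isCellPartition_equalCell h.one_le h.mem_Icc
  have hx1 := h.one_le_complexity
  have hxε := h.inv_le_complexity
  have hxn := h.cellComplexity_mul_le
  set x := cellComplexity K κ ε δ with hx
  set N := ⌈x⌉₊ with hNdef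
  have hxN : x ≤ N := Nat.le_ceil x
  have hN2 : (N : ℝ) ≤ 2 * x := by
    have := (Nat.ceil_lt_add_one (by linarith : 0 ≤ x)).le
    linarith
  have hN1 : 1 ≤ N := Nat.one_le_ceil_iff.mpr (by linarith)
  refine ⟨m + 7 * (K * N) + 1, ?_, ?_⟩
  · refine (measure_mono (t := {D | ∃ k i, (cellPrefix (equalCell Z K k) D i).card ≠ 0 ∧
      19 / 20 * radiusFn K δ (empVar Z D (cellPrefix (equalCell Z K k) D i))
        (cellPrefix (equalCell Z K k) D i).card <
        |empMean Z D (cellPrefix (equalCell Z K k) D i) - cellMean P Z (equalCell Z K k)|} ∪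
      {D | ∃ k, share (equalCell Z K) D k < P.real (equalCell Z K k) / 2} ∪
      {D | ε / 40 < |∑ k, share (equalCell Z K) D k * cellMean P Z (equalCell Z K k) -
        ∫ x, Z x ∂P|}) fun D hD => ?_).trans ?_
    · by_contra hcon
      simp only [Set.mem_union, Set.mem_ofPred_eq, not_or, not_exists, not_and, not_lt] at hcon
      obtain ⟨⟨hcell, hshare⟩, hbetween⟩ := hcon
      have hgroup : ∀ j, N ≤ (group (equalCell Z K) D j).card := by
        intro j
        have h1 := hshare j
        rw [share, le_div_iff₀ h.size_pos] at h1
        have h2 := mul_le_mul_of_nonneg_left (h.mass j) h.size_pos.le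
        have h3 : (N : ℝ) ≤ (group (equalCell Z K) D j).card := by linarith
        exact_mod_cast h3
      have hrad : ∀ S j, N ≤ (seen (equalCell Z K) D S j).card →
          radiusFn K δ (groupVar Z (equalCell Z K) D S j)
            (seen (equalCell Z K) D S j).card ≤ ε / 4 := by
        intro S j hj
        refine radiusFn_le_quarter h.one_le h.le_inv h.small h.delta_pos h.delta_le h.kappa_pos
          h.sq_le h.kappa_le groupVar_nonneg
          ((groupVar_equalCell_le h.one_le D S j).trans h.le_kappa) (hxN.trans ?_)
        exact_mod_cast hj
      have hsε : ∀ j, ε ≤ share (equalCell Z K) D j := by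
        intro j
        have h1 := mul_le_mul_of_nonneg_right (le_log_add_one h.one_le) h.kappa_pos.le
        linarith [hshare j, h.mass j, h.le_kappa_div_ten, h.kappa_pos]
      rcases hD with hD | hD | ⟨t, ht⟩
      · have hcard := card_evaluatedSet_le h.delta_pos h.delta_le h0 hA h.size_ne hN1 hgroup hrad
          m n
        have hcard' : (evaluatedSet Z (equalCell Z K) δ D ε m n).card ≤ m + 7 * (K * N) := by
          exact_mod_cast hcard
        have hD' : m + 7 * (K * N) + 1 ≤ (evaluatedSet Z (equalCell Z K) δ D ε m n).card := hD
        omega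
      · exact absurd (hD n) (not_lt.mpr (ciRadius_le h0 hA h.size_ne hN1 hgroup hrad m))
      · refine absurd ht (not_lt.mpr ?_)
        refine abs_estimate_sub_le (fun j => h0.trans_le (hsε j)) (fun j hj => ?_) hbetween
          (half_le_ciRadius h.one_le h.delta_pos h.delta_le h0 hA h.size_ne hm hsε t)
        obtain ⟨i, hi⟩ := seen_eq_cellPrefix (Z := Z) (δ := δ) (ε := ε) (D := D) hA m t j
        have h1 := hcell j i
        rw [← hi] at h1
        exact h1 hj
    -- The failure probabilities add up to 3δ/8 + δ/8 + δ/4 ≤ δ.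
    · have hδ := h.delta_pos
      refine (measure_union_le _ _).trans ((add_le_add ((measure_union_le _ _).trans
        (add_le_add h.measure_cells_gt h.measure_share_lt)) h.measure_between_gt).trans ?_)
      rw [← ENNReal.ofReal_add (by positivity) (by positivity),
        ← ENNReal.ofReal_add (by positivity) (by positivity)]
      exact ENNReal.ofReal_le_ofReal (by linarith)
  · rw [div_le_iff₀ h.size_pos]
    push_cast
    -- m ≤ Kx, 7KN ≤ 14Kx and 1 ≤ Kx add up to 16Kx ≤ 4nKκΛ.
    have h1 : (K : ℝ) * N ≤ K * (2 * x) := mul_le_mul_of_nonneg_left hN2 (by linarith)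
    have h2 : 1 * x ≤ K * x := mul_le_mul_of_nonneg_right hK (by linarith)
    have h3 := mul_le_mul_of_nonneg_left hxn (by linarith : (0 : ℝ) ≤ K)
    linarith

end Admissible

/-! ### The choice of κ in the two regimes. -/

section Rates

variable {E : Type*} [MeasurableSpace E] {P : Measure E} [IsProbabilityMeasure P]
  {Z : E → ℝ} {K n : ℕ} {κ ε δ : ℝ}

/-- Reduces benignity to the mass condition, since κ dominates both 1/K² and ε^(2/3). -/
lemma Admissible.log_mul_max_le (h : Admissible P Z K n κ ε δ) (k : Fin K) :
    Real.log ((K : ℝ) + 1) * max (cellVar P Z (equalCell Z K) k) (ε ^ (2 / 3 : ℝ)) ≤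
      Real.log ((K : ℝ) + 1) * κ := by
  refine mul_le_mul_of_nonneg_left (max_le ?_ ?_) (by linarith [le_log_add_one h.one_le])
  · exact (cellVar_equalCell_le h.one_le h.measurable (h.mass_pos k)).trans h.le_kappa
  · have h0 := h.small.pos
    refine le_of_pow_le_pow_left₀ (n := 3) (by norm_num) h.kappa_pos.le (le_trans (le_of_eq ?_)
      h.sq_le)
    rw [← Real.rpow_natCast (ε ^ (2 / 3 : ℝ)), ← Real.rpow_mul h0.le, ← Real.rpow_natCast]
    norm_num

lemma pow_three_mul_le {ε B x : ℝ} (hε : 0 < ε) (hx : 0 ≤ x)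
    (h : x ≤ B * ε ^ (-(1 / 3) : ℝ)) : x ^ 3 * ε ≤ B ^ 3 := by
  have h1 := pow_le_pow_left₀ hx h 3
  have h2 : (ε ^ (-(1 / 3) : ℝ)) ^ 3 = ε⁻¹ := by
    rw [← Real.rpow_natCast, ← Real.rpow_mul hε.le]
    norm_num [Real.rpow_neg_one]
  rw [mul_pow, h2] at h1
  calc _ ≤ B ^ 3 * ε⁻¹ * ε := mul_le_mul_of_nonneg_right h1 hε.le
    _ = _ := by field_simp

lemma admissible_of_le_inv_cbrt (hZ : Measurable Z) (h01 : ∀ x, Z x ∈ Set.Icc (0 : ℝ) 1)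
    {A σ : ℝ} (hA : 0 < A) (h : HasSuperGaussianLoss P Z A σ) (hε : IsSmall ε)
    (hδ : 0 < δ) (hδ1 : δ ≤ 1)
    (hK : Real.exp (1 / σ ^ 2) / A ≤ (K : ℝ) / Real.log ((K : ℝ) + 1))
    (hKε : (K : ℝ) ≤ ε ^ (-(1 / 3) : ℝ)) (hn : 54000 * baseComplexity ε δ ≤ n) :
    Admissible P Z K n (1 / (K : ℝ) ^ 2) ε δ := by
  have h0 := hε.pos
  have hK1 : 1 ≤ K := by
    -- For K = 0 the quotient K / ln(K + 1) is 0 in Lean, below the positive threshold.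
    rcases Nat.eq_zero_or_pos K with rfl | hpos
    · have : 0 < Real.exp (1 / σ ^ 2) / A := div_pos (Real.exp_pos _) hA
      rw [Nat.cast_zero, zero_div] at hK
      linarith
    · exact hpos
  have hK' : (1 : ℝ) ≤ K := by exact_mod_cast hK1
  have hK3 : (K : ℝ) ^ 3 * ε ≤ 1 := by
    have := pow_three_mul_le (B := 1) h0 (by linarith : (0 : ℝ) ≤ K) (by rwa [one_mul])
    simpa using this
  refine ⟨hZ, h01, hε, hδ, hδ1, hK1, ?_, ?_, ?_, le_rfl, hn, fun k => ?_⟩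
  · rw [le_div_iff₀ h0]
    refine le_trans (mul_le_mul_of_nonneg_right ?_ h0.le) hK3
    exact le_self_pow₀ hK' (by norm_num)
  -- For κ = 1/K² the condition ε² ≤ κ³ is K³ε ≤ 1, squared.
  · rw [one_div_pow, le_div_iff₀ (by positivity)]
    calc _ = ((K : ℝ) ^ 3 * ε) ^ 2 := by ring
      _ ≤ 1 := pow_le_one₀ (by positivity) hK3
  · rw [div_le_one (by positivity)]
    exact one_le_pow₀ hK'
  · refine le_trans ?_ (le_measureReal_equalCell hK1 hZ hA h k)
    have hΛ : 0 < Real.log ((K : ℝ) + 1) := by linarith [le_log_add_one hK1]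
    rw [div_le_div_iff₀ hA hΛ] at hK
    have e : A * Real.exp (-1 / σ ^ 2) = A / Real.exp (1 / σ ^ 2) := by
      rw [neg_div, Real.exp_neg, ← div_eq_mul_inv]
    rw [e, div_div, mul_one_div, div_le_div_iff₀ (by positivity) (by positivity)]
    have := mul_le_mul_of_nonneg_right hK (by linarith : (0 : ℝ) ≤ K)
    linarith

/-- The conditions on the error level under which the rate `ε ^ (1 / 3) ln (1 / ε)` holds for `K` of
order `ε ^ (-1 / 3)`, where `a` is the mass constant of the cells. -/
lemma exists_error_level {a B M : ℝ} (ha : 0 < a) :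
    ∃ ε₀ : ℝ, 0 < ε₀ ∧ ∀ ε : ℝ, 0 < ε → ε ≤ ε₀ → IsSmall ε ∧
      B * ε ^ (-(1 / 3) : ℝ) + 1 ≤ 1 / ε ∧ M * (ε ^ (1 / 3 : ℝ) * Real.log (1 / ε)) ≤ a := by
  have h1 : Filter.Tendsto (fun ε : ℝ => M * (ε ^ (1 / 3 : ℝ) * Real.log (1 / ε)))
      (nhdsWithin 0 (Set.Ioi 0)) (nhds 0) := by
    have := (tendsto_log_mul_rpow_nhdsGT_zero (by norm_num : (0 : ℝ) < 1 / 3)).const_mul (-M)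
    rw [mul_zero] at this
    refine this.congr fun ε => ?_
    rw [one_div ε, Real.log_inv]; ring
  have h2 : Filter.Tendsto (fun ε : ℝ => B * ε ^ (2 / 3 : ℝ) + ε)
      (nhdsWithin 0 (Set.Ioi 0)) (nhds 0) := by
    have hc : ContinuousAt (fun ε : ℝ => B * ε ^ (2 / 3 : ℝ) + ε) 0 :=
      ((Real.continuousAt_rpow_const 0 (2 / 3) (Or.inr (by norm_num))).const_mul B).add
        continuousAt_id
    have := hc.tendsto.mono_left (nhdsWithin_le_nhds (s := Set.Ioi (0 : ℝ)))
    simpa using this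
  have h3 : ∀ᶠ ε in nhdsWithin (0 : ℝ) (Set.Ioi 0), ε < Real.exp (-Real.exp 12) :=
    nhdsWithin_le_nhds (gt_mem_nhds (Real.exp_pos _))
  have h4 := (h1.eventually_lt_const ha).and ((h2.eventually_lt_const one_pos).and h3)
  obtain ⟨u, hu, hsub⟩ := mem_nhdsGT_iff_exists_Ioc_subset.mp h4
  refine ⟨u, hu, fun ε hε hεu => ?_⟩
  obtain ⟨e1, e2, e3⟩ := hsub ⟨hε, hεu⟩
  refine ⟨⟨hε, e3.le⟩, ?_, e1.le⟩
  rw [le_div_iff₀ hε, add_mul, one_mul, mul_assoc, ← Real.rpow_add_one hε.ne']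
  norm_num
  norm_num at e2
  exact e2.le

/-- The parameter `κ` of the partition into about `ε ^ (-1 / 3)` cells. -/
lemma admissible_of_order_inv_cbrt (hZ : Measurable Z) (h01 : ∀ x, Z x ∈ Set.Icc (0 : ℝ) 1)
    {A σ b B : ℝ} (hA : 0 < A) (h : HasSuperGaussianLoss P Z A σ) (hε : IsSmall ε)
    (hδ : 0 < δ) (hδ1 : δ ≤ 1) (hb : 0 < b)
    (hK1 : b * ε ^ (-(1 / 3) : ℝ) ≤ K) (hK2 : (K : ℝ) ≤ B * ε ^ (-(1 / 3) : ℝ))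
    (hB : B * ε ^ (-(1 / 3) : ℝ) + 1 ≤ 1 / ε)
    (hM : 2 * (B * (1 / b ^ 2 + 1)) * (ε ^ (1 / 3 : ℝ) * Real.log (1 / ε)) ≤
      A * Real.exp (-1 / σ ^ 2))
    (hn : 54000 * baseComplexity ε δ ≤ n) :
    Admissible P Z K n (max (1 / (K : ℝ) ^ 2) (ε ^ (2 / 3 : ℝ))) ε δ ∧
      (∀ k, 2 * (Real.log ((K : ℝ) + 1) * max (1 / (K : ℝ) ^ 2) (ε ^ (2 / 3 : ℝ))) ≤
        P.real (equalCell Z K k)) ∧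
      K * max (1 / (K : ℝ) ^ 2) (ε ^ (2 / 3 : ℝ)) * Real.log ((K : ℝ) + 1) ≤
        B * (1 / b ^ 2 + 1) * (ε ^ (1 / 3 : ℝ) * Real.log (1 / ε)) := by
  have h0 := hε.pos
  have hr0 : 0 < ε ^ (-(1 / 3) : ℝ) := Real.rpow_pos_of_pos h0 _
  have hK0 : (0 : ℝ) < K := lt_of_lt_of_le (mul_pos hb hr0) hK1
  have hKn : 1 ≤ K := by exact_mod_cast hK0
  have hK' : (1 : ℝ) ≤ K := by exact_mod_cast hKn
  have hε1 : ε ≤ 1 := hε.le_inv.trans (by norm_num)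
  have hr2 : (ε ^ (-(1 / 3) : ℝ)) * ε ^ (2 / 3 : ℝ) = ε ^ (1 / 3 : ℝ) := by
    rw [← Real.rpow_add h0]; norm_num
  have hr3 : (ε ^ (-(1 / 3) : ℝ)) ^ 2 * ε ^ (2 / 3 : ℝ) = 1 := by
    rw [← Real.rpow_natCast, ← Real.rpow_mul h0.le, ← Real.rpow_add h0]; norm_num
  have hr4 : (ε ^ (2 / 3 : ℝ)) ^ 3 = ε ^ 2 := by
    rw [← Real.rpow_natCast, ← Real.rpow_mul h0.le, ← Real.rpow_natCast]; norm_num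
  have hp : 0 < ε ^ (2 / 3 : ℝ) := Real.rpow_pos_of_pos h0 _
  have hp1 : ε ^ (2 / 3 : ℝ) ≤ 1 := Real.rpow_le_one h0.le hε1 (by norm_num)
  set p := ε ^ (2 / 3 : ℝ)
  set q := ε ^ (-(1 / 3) : ℝ)
  set κ := max (1 / (K : ℝ) ^ 2) p with hκdef
  have hκ : κ ≤ (1 / b ^ 2 + 1) * p := by
    refine max_le ?_ ?_
    · have h1 : (b * q) ^ 2 ≤ (K : ℝ) ^ 2 := pow_le_pow_left₀ (by positivity) hK1 2
      have h2 : 1 / (K : ℝ) ^ 2 ≤ 1 / b ^ 2 * p := by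
        rw [div_mul_eq_mul_div, one_mul, div_le_div_iff₀ (by positivity) (by positivity), one_mul]
        calc b ^ 2 = (b * q) ^ 2 * p := by rw [mul_pow, mul_assoc, hr3, mul_one]
          _ ≤ _ := by rw [mul_comm p]; exact mul_le_mul_of_nonneg_right h1 hp.le
      linarith
    · have : 0 ≤ 1 / b ^ 2 * p := by positivity
      linarith
  have hlog : Real.log ((K : ℝ) + 1) ≤ Real.log (1 / ε) :=
    Real.log_le_log (by linarith) (by linarith)
  have hΛ : 0 < Real.log ((K : ℝ) + 1) := by linarith [le_log_add_one hKn]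
  have hκ0 : 0 < κ := lt_max_of_lt_right hp
  have hrate : K * κ * Real.log ((K : ℝ) + 1) ≤
      B * (1 / b ^ 2 + 1) * (ε ^ (1 / 3 : ℝ) * Real.log (1 / ε)) := by
    have hBq : 0 < B * q := hK0.trans_le hK2
    calc _ ≤ (B * q) * ((1 / b ^ 2 + 1) * p) * Real.log (1 / ε) := by gcongr
      _ = B * (1 / b ^ 2 + 1) * ((q * p) * Real.log (1 / ε)) := by ring
      _ = _ := by rw [hr2]
  -- The factor 2 leaves room for empirical shares that are only half of the cell masses.
  have hmass : ∀ k, 2 * (Real.log ((K : ℝ) + 1) * κ) ≤ P.real (equalCell Z K k) := by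
    intro k
    refine le_trans ?_ (le_measureReal_equalCell hKn hZ hA h k)
    rw [le_div_iff₀ hK0]
    linarith
  refine ⟨⟨hZ, h01, hε, hδ, hδ1, hKn, by linarith, ?_, ?_, le_max_left _ _, hn, fun k => ?_⟩,
    hmass, hrate⟩
  · rw [← hr4]; exact pow_le_pow_left₀ hp.le (le_max_right _ _) 3
  · refine max_le ?_ hp1
    rw [div_le_one (by positivity)]
    exact one_le_pow₀ hK'
  · have := hmass k
    have := mul_pos hΛ hκ0
    linarith

end Rates

end CerEval

end

theorem corollary1 :
    ∃ c₀ : ℝ, 0 < c₀ ∧ ∀ c₁ : ℝ, c₀ ≤ c₁ →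
      -- part one: the rate `ln (K + 1) / K`
      (∃ C : ℝ, 0 < C ∧ ∃ ε₀ : ℝ, 0 < ε₀ ∧
        ∀ (𝒳 : Type*) (𝒴 : Type*) [MeasurableSpace 𝒳] [MeasurableSpace 𝒴]
          (P : Measure (𝒳 × 𝒴)) [IsProbabilityMeasure P] (f : 𝒳 → 𝒴) (l : 𝒴 → 𝒴 → ℝ),
        Measurable (CerEval.loss f l) →
        (∀ p, CerEval.loss f l p ∈ Set.Icc (0 : ℝ) 1) →
        ∀ A σ : ℝ, 0 < A → 0 < σ → CerEval.HasSuperGaussianLoss P (CerEval.loss f l) A σ →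
        ∀ ε δ : ℝ, 0 < ε → ε ≤ ε₀ → 0 < δ → δ < 1 →
        ∀ K n m : ℕ,
        Real.exp (1 / σ ^ 2) / A ≤ (K : ℝ) / Real.log ((K : ℝ) + 1) →
        (K : ℝ) ≤ ε ^ (-(1 / 3) : ℝ) →
        c₀ * CerEval.baseComplexity ε δ ≤ n → (n : ℝ) ≤ c₁ * CerEval.baseComplexity ε δ →
        (m : ℝ) ≤ 1 / ε →
        CerEval.IsBenign
            (fun k => P.real (CerEval.equalCell (CerEval.loss f l) K k))
            (CerEval.cellVar P (CerEval.loss f l) (CerEval.equalCell (CerEval.loss f l) K)) ε ∧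
          (Measure.pi fun _ : Fin n => P) {D | ¬ CerEval.IsBenign
            (fun k => 2 * CerEval.share (CerEval.equalCell (CerEval.loss f l) K) D k)
            (CerEval.cellVar P (CerEval.loss f l) (CerEval.equalCell (CerEval.loss f l) K)) ε}
              ≤ ENNReal.ofReal δ ∧
          ∃ n' : ℕ, CerEval.EqualCertified P (CerEval.loss f l) K n m ε δ n' ∧
            (n' : ℝ) / n ≤ C * (Real.log ((K : ℝ) + 1) / K)) ∧
      -- part two: the rate `ε ^ (1 / 3) ln (1 / ε)` for `K` of order `ε ^ (-1 / 3)`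
      (∀ b B : ℝ, 0 < b → b ≤ B → ∃ C : ℝ, 0 < C ∧ ∀ A σ : ℝ, 0 < A → 0 < σ →
        ∃ ε₀ : ℝ, 0 < ε₀ ∧
        ∀ (𝒳 : Type*) (𝒴 : Type*) [MeasurableSpace 𝒳] [MeasurableSpace 𝒴]
          (P : Measure (𝒳 × 𝒴)) [IsProbabilityMeasure P] (f : 𝒳 → 𝒴) (l : 𝒴 → 𝒴 → ℝ),
        Measurable (CerEval.loss f l) →
        (∀ p, CerEval.loss f l p ∈ Set.Icc (0 : ℝ) 1) →
        CerEval.HasSuperGaussianLoss P (CerEval.loss f l) A σ →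
        ∀ ε δ : ℝ, 0 < ε → ε ≤ ε₀ → 0 < δ → δ < 1 →
        ∀ K n m : ℕ,
        b * ε ^ (-(1 / 3) : ℝ) ≤ K → (K : ℝ) ≤ B * ε ^ (-(1 / 3) : ℝ) →
        c₀ * CerEval.baseComplexity ε δ ≤ n → (n : ℝ) ≤ c₁ * CerEval.baseComplexity ε δ →
        (m : ℝ) ≤ 1 / ε →
        (Measure.pi fun _ : Fin n => P) {D | ¬ CerEval.IsBenign
            (fun k => CerEval.share (CerEval.equalCell (CerEval.loss f l) K) D k)
            (CerEval.cellVar P (CerEval.loss f l) (CerEval.equalCell (CerEval.loss f l) K)) ε}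
              ≤ ENNReal.ofReal δ ∧
          ∃ n' : ℕ, CerEval.EqualCertified P (CerEval.loss f l) K n m ε δ n' ∧
            (n' : ℝ) / n ≤ C * (ε ^ (1 / 3 : ℝ) * Real.log (1 / ε))) := by
  refine ⟨54000, by norm_num, fun c₁ _ => ⟨⟨5, by norm_num, Real.exp (-Real.exp 12),
    Real.exp_pos _, ?_⟩, ?_⟩⟩
  · intro 𝒳 𝒴 _ _ P _ f l hZ h01 A σ hA _ hG ε δ hε hε0 hδ hδ1 K n m hK hKε hn _ hm
    have h := CerEval.admissible_of_le_inv_cbrt hZ h01 hA hG ⟨hε, hε0⟩ hδ hδ1.le hK hKε hn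
    have hK0 : (0 : ℝ) < K := by exact_mod_cast h.one_le
    refine ⟨fun k => (h.log_mul_max_le k).trans (h.mass k), ?_, ?_⟩
    · refine (measure_mono fun D hD => ?_).trans
        (h.measure_share_lt.trans (ENNReal.ofReal_le_ofReal (by linarith)))
      by_contra hcon
      simp only [Set.mem_ofPred_eq, not_exists, not_lt] at hcon
      exact hD fun k => ((h.log_mul_max_le k).trans (h.mass k)).trans (by linarith [hcon k])
    · obtain ⟨n', h1, h2⟩ := h.exists_equalCertified hm
      refine ⟨n', h1, h2.trans (le_of_eq ?_)⟩
      field_simp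
  · intro b B hb hbB
    have hB : 0 < B := hb.trans_le hbB
    refine ⟨5 * (B * (1 / b ^ 2 + 1)), by positivity, fun A σ hA _ => ?_⟩
    obtain ⟨ε₀, hε₀, hlevel⟩ := CerEval.exists_error_level (a := A * Real.exp (-1 / σ ^ 2))
      (B := B) (M := 2 * (B * (1 / b ^ 2 + 1))) (by positivity)
    refine ⟨ε₀, hε₀, ?_⟩
    intro 𝒳 𝒴 _ _ P _ f l hZ h01 hG ε δ hε hεε₀ hδ hδ1 K n m hK1 hK2 hn _ hm
    obtain ⟨hs, hBε, hM⟩ := hlevel ε hε hεε₀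
    obtain ⟨h, hmass, hrate⟩ := CerEval.admissible_of_order_inv_cbrt hZ h01 hA hG hs hδ hδ1.le hb
      hK1 hK2 hBε hM hn
    refine ⟨?_, ?_⟩
    · refine (measure_mono fun D hD => ?_).trans
        (h.measure_share_lt.trans (ENNReal.ofReal_le_ofReal (by linarith)))
      by_contra hcon
      simp only [Set.mem_ofPred_eq, not_exists, not_lt] at hcon
      exact hD fun k => (h.log_mul_max_le k).trans (by linarith [hcon k, hmass k])
    · obtain ⟨n', h1, h2⟩ := h.exists_equalCertified hm
      exact ⟨n', h1, h2.trans (by linarith)⟩
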